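/- Let $d\ge 2$ and let $\Omega,B\subset\mathbb{R}^d$ be bounded open sets with Lipschitz boundaries $\Gamma:=\partial\Omega$ and $\partial B$, such that $\overline{B}\subset\Omega$. Let $H^{1/2}(\Gamma;\mathbb{R}^d)\subset L^2(\Gamma;\mathbb{R}^d)$ be the image of the trace operator of $H^1(\Omega;\mathbb{R}^d)$ on $\Gamma$, with the quotient norm, and let $H^{-1/2}(\Gamma;\mathbb{R}^d)$ be its dual, in which $L^2(\Gamma;\mathbb{R}^d)$ is embedded by $h\mapsto (h,\cdot)_{L^2(\Gamma;\mathbb{R}^d)}$. For $g\in H^{1/2}(\Gamma;\mathbb{R}^d)$ let $v(g)\in H^1(\Omega\setminus\overline{B};\mathbb{R}^d)$ be the weak solution of $$-\Delta v=0\ \text{ in }\Omega\setminus\overline{B},\qquad v=0\ \text{ on }\partial B,\qquad v=g\ \text{ on }\Gamma,$$ and let $\Lambda g=\nabla v(g)\cdot\nu\in H^{-1/2}(\Gamma;\mathbb{R}^d)$ be the Dirichlet-to-Neumann map, where the normal derivative is understood weakly: $\langle\Lambda g,\psi\rangle=\int_{\Omega\setminus\overline{B}}\nabla v(g):\nabla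 w\,dx$ for all $\psi\in H^{1/2}(\Gamma;\mathbb{R}^d)$ and all $w\in H^1(\Omega\setminus\overline{B};\mathbb{R}^d)$ with $w=\psi$ on $\Gamma$ and $w=0$ on $\partial B$. For every $g$, the weak solution $v(g)$ exists and is unique, and $\Lambda g$ is well defined. Let $\varepsilon>0$ and $g\in H^{1/2}(\Gamma;\mathbb{R}^d)$. Then there is a unique $g^\varepsilon\in H^{1/2}(\Gamma;\mathbb{R}^d)$ with $$\varepsilon\langle\Lambda g^\varepsilon,\varphi\rangle+(g^\varepsilon,\varphi)_{L^2(\Gamma;\mathbb{R}^d)}=(g,\varphi)_{L^2(\Gamma;\mathbb{R}^d)}\qquad\text{for all }\varphi\in H^{1/2}(\Gamma;\mathbb{R}^d),$$ and, if $\Lambda g\in L^2(\Gamma;\mathbb{R}^d)$, then $$\|g^\varepsilon-g\|_{L^2(\Gamma;\mathbb{R}^d)}\le\varepsilon\,\|\Lambda g\|_{L^2(\Gamma;\mathbb{R}^d)}.$$ -/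

import Mathlib

open MeasureTheory Filter Topology
open scoped ENNReal NNReal ContDiff

noncomputable section

namespace CMM

/-- The Euclidean space `ℝ^d`. -/
abbrev Vec (d : ℕ) : Type := EuclideanSpace ℝ (Fin d)

/-- The `j`-th standard basis vector of `ℝ^d`. -/
abbrev basisVec {d : ℕ} (j : Fin d) : Vec d := EuclideanSpace.single j (1 : ℝ)

/-- `Ω` is a bounded open set with Lipschitz boundary: near every boundary point, `Ω` is the strict
epigraph of a Lipschitz function of the variables orthogonal to some unit vector `e`. -/
structure IsBoundedLipschitz {d : ℕ} (Ω : Set (Vec d)) : Prop where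
  isOpen : IsOpen Ω
  isBounded : Bornology.IsBounded Ω
  lipschitz : ∀ x ∈ frontier Ω, ∃ V : Set (Vec d), IsOpen V ∧ x ∈ V ∧
    ∃ e : Vec d, ‖e‖ = 1 ∧ ∃ (K : ℝ≥0) (γ : (ℝ ∙ e)ᗮ → ℝ), LipschitzWith K γ ∧
      Ω ∩ V = {y ∈ V | γ ((ℝ ∙ e)ᗮ.orthogonalProjectionOnto y) < inner ℝ e y}

/-- The surface measure on a hypersurface `S` of `ℝ^d`: the `(d-1)`-dimensional Hausdorff measure
(normalised so as to agree with the Lebesgue measure on hyperplanes), restricted to `S`. -/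
def surfaceMeasure {d : ℕ} (S : Set (Vec d)) : Measure (Vec d) :=
  (μHE[d - 1] : Measure (Vec d)).restrict S

/-- `L²(U; ℝ^d)` for `U ⊆ ℝ^d` with the Lebesgue measure. -/
abbrev L2Vol {d : ℕ} (U : Set (Vec d)) : Type :=
  Lp (Vec d) 2 ((volume : Measure (Vec d)).restrict U)

/-- `L²(S; ℝ^d)` for a hypersurface `S` with the surface measure. -/
abbrev L2Surf {d : ℕ} (S : Set (Vec d)) : Type := Lp (Vec d) 2 (surfaceMeasure S)

/-- `w` is the weak partial derivative `∂_j v` on `U`. -/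
def IsWeakPartial {d : ℕ} (U : Set (Vec d)) (j : Fin d) (v w : L2Vol U) : Prop :=
  ∀ φ : Vec d → ℝ, ContDiff ℝ ∞ φ → HasCompactSupport φ → tsupport φ ⊆ U →
    ∫ x in U, (fderiv ℝ φ x (basisVec j)) • v x = - ∫ x in U, φ x • w x

/-- The Hilbert space of pairs `(v, (w_1, …, w_d))` of elements of `L²(U; ℝ^d)`, with
`‖(v, w)‖² = ‖v‖² + ∑ j, ‖w_j‖²`. -/
abbrev PairSpace {d : ℕ} (U : Set (Vec d)) : Type :=
  WithLp 2 (L2Vol U × PiLp 2 (fun _ : Fin d => L2Vol U))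

lemma integrable_test_smul {d : ℕ} {U : Set (Vec d)} {f : Vec d → ℝ} (hf : Continuous f)
    (hc : HasCompactSupport f) (v : L2Vol U) :
    Integrable (fun x => f x • v x) ((volume : Measure (Vec d)).restrict U) := by
  have h1 : MemLp f 2 ((volume : Measure (Vec d)).restrict U) :=
    hf.memLp_of_hasCompactSupport hc
  exact memLp_one_iff_integrable.1 ((Lp.memLp v).smul h1)

lemma continuous_partial {d : ℕ} {φ : Vec d → ℝ} (hφ : ContDiff ℝ ∞ φ) (j : Fin d) :
    Continuous (fun x => fderiv ℝ φ x (basisVec j)) :=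
  (hφ.continuous_fderiv (by simp)).clm_apply continuous_const

lemma compact_partial {d : ℕ} {φ : Vec d → ℝ} (hc : HasCompactSupport φ) (j : Fin d) :
    HasCompactSupport (fun x => fderiv ℝ φ x (basisVec j)) :=
  hc.fderiv_apply (𝕜 := ℝ) (basisVec j)

lemma IsWeakPartial.zero {d : ℕ} (U : Set (Vec d)) (j : Fin d) :
    IsWeakPartial U j (0 : L2Vol U) (0 : L2Vol U) := by
  intro φ _ _ _
  have h0 := Lp.coeFn_zero (Vec d) 2 ((volume : Measure (Vec d)).restrict U)
  rw [integral_congr_ae (g := fun _ => (0 : Vec d)),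
    integral_congr_ae (f := fun x => φ x • (0 : L2Vol U) x) (g := fun _ => (0 : Vec d))]
  · simp
  · filter_upwards [h0] with x hx
    exact (congrArg (fun z : Vec d => φ x • z) hx).trans (smul_zero _)
  · filter_upwards [h0] with x hx
    exact (congrArg (fun z : Vec d => (fderiv ℝ φ x (basisVec j)) • z) hx).trans (smul_zero _)

lemma IsWeakPartial.add {d : ℕ} {U : Set (Vec d)} {j : Fin d} {v w v' w' : L2Vol U}
    (h : IsWeakPartial U j v w) (h' : IsWeakPartial U j v' w') :
    IsWeakPartial U j (v + v') (w + w') := by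
  intro φ hφ hc hs
  have e1 : ∫ x in U, (fderiv ℝ φ x (basisVec j)) • (v + v') x
      = ∫ x in U, ((fderiv ℝ φ x (basisVec j)) • v x + (fderiv ℝ φ x (basisVec j)) • v' x) := by
    apply integral_congr_ae
    filter_upwards [Lp.coeFn_add v v'] with x hx
    rw [hx, Pi.add_apply, smul_add]
  have e2 : ∫ x in U, φ x • (w + w') x = ∫ x in U, (φ x • w x + φ x • w' x) := by
    apply integral_congr_ae
    filter_upwards [Lp.coeFn_add w w'] with x hx
    rw [hx, Pi.add_apply, smul_add]
  have c1 := continuous_partial hφ j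
  have c2 := compact_partial hc j
  rw [e1, e2, integral_add (integrable_test_smul c1 c2 v) (integrable_test_smul c1 c2 v'),
    integral_add (integrable_test_smul hφ.continuous hc w)
      (integrable_test_smul hφ.continuous hc w'), h φ hφ hc hs, h' φ hφ hc hs, neg_add]

lemma IsWeakPartial.smul {d : ℕ} {U : Set (Vec d)} {j : Fin d} {v w : L2Vol U} (c : ℝ)
    (h : IsWeakPartial U j v w) : IsWeakPartial U j (c • v) (c • w) := by
  intro φ hφ hc hs
  have e1 : ∫ x in U, (fderiv ℝ φ x (basisVec j)) • (c • v) x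
      = ∫ x in U, c • ((fderiv ℝ φ x (basisVec j)) • v x) := by
    apply integral_congr_ae
    filter_upwards [Lp.coeFn_smul c v] with x hx
    rw [hx, Pi.smul_apply, smul_comm]
  have e2 : ∫ x in U, φ x • (c • w) x = ∫ x in U, c • (φ x • w x) := by
    apply integral_congr_ae
    filter_upwards [Lp.coeFn_smul c w] with x hx
    rw [hx, Pi.smul_apply, smul_comm]
  rw [e1, e2, integral_smul, integral_smul, h φ hφ hc hs, smul_neg]

/-- The Sobolev space `H¹(U; ℝ^d)`; an element is the pair `(v, ∇v)` of a function in `L²` and its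
(unique) weak gradient in `L²`. -/
def H1 {d : ℕ} (U : Set (Vec d)) : Submodule ℝ (PairSpace U) where
  carrier := {p | ∀ j, IsWeakPartial U j p.fst (p.snd j)}
  zero_mem' := fun j => IsWeakPartial.zero U j
  add_mem' := fun ha hb j => (ha j).add (hb j)
  smul_mem' := fun c _ ha j => (ha j).smul c

/-- The weak gradient `(∂_1 v, …, ∂_d v)` of `v ∈ H¹(U; ℝ^d)`. -/
def grad {d : ℕ} {U : Set (Vec d)} (v : H1 U) : PiLp 2 (fun _ : Fin d => L2Vol U) :=
  (v : PairSpace U).snd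

/-- The Dirichlet form `∫_U ∇v : ∇w dx = ∑ j, ∫_U ∂_j v · ∂_j w dx`. -/
def dirichletForm {d : ℕ} {U : Set (Vec d)} (v w : H1 U) : ℝ := ∑ j, inner ℝ (grad v j) (grad w j)

/-- The graph `{((φ|_U, ∇φ|_U), φ|_S)}` of the restriction to `S` of smooth functions on `ℝ^d`. -/
def smoothGraph {d : ℕ} (U S : Set (Vec d)) : Submodule ℝ (PairSpace U × L2Surf S) where
  carrier := {p | ∃ φ : Vec d → Vec d, ContDiff ℝ ∞ φ ∧
    (p.1.fst =ᵐ[(volume : Measure (Vec d)).restrict U] φ) ∧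
    (∀ j, p.1.snd j =ᵐ[(volume : Measure (Vec d)).restrict U]
      fun x => fderiv ℝ φ x (basisVec j)) ∧
    (p.2 =ᵐ[surfaceMeasure S] φ)}
  zero_mem' := by
    refine ⟨fun _ => 0, contDiff_const, ?_, fun j => ?_, ?_⟩
    · exact Lp.coeFn_zero _ _ _
    · refine (Lp.coeFn_zero _ _ _).trans (Eventually.of_forall fun x => ?_)
      simp
    · exact Lp.coeFn_zero _ _ _
  add_mem' := by
    rintro a b ⟨φ, hφ, h1, h2, h3⟩ ⟨ψ, hψ, k1, k2, k3⟩
    refine ⟨φ + ψ, hφ.add hψ, ?_, fun j => ?_, ?_⟩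
    · exact (Lp.coeFn_add _ _).trans (h1.add k1)
    · refine (Lp.coeFn_add _ _).trans (((h2 j).add (k2 j)).trans (Eventually.of_forall fun x => ?_))
      have := fderiv_add (𝕜 := ℝ) (hφ.differentiable (by simp) x) (hψ.differentiable (by simp) x)
      simp [this]
    · exact (Lp.coeFn_add _ _).trans (h3.add k3)
  smul_mem' := by
    rintro c a ⟨φ, hφ, h1, h2, h3⟩
    refine ⟨c • φ, contDiff_const.smul hφ, ?_, fun j => ?_, ?_⟩
    · exact (Lp.coeFn_smul _ _).trans (h1.const_smul c)
    · refine (Lp.coeFn_smul _ _).trans (((h2 j).const_smul c).trans (Eventually.of_forall fun x => ?_))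
      have := fderiv_const_smul (𝕜 := ℝ) (hφ.differentiable (by simp) x) c
      simp [this]
    · exact (Lp.coeFn_smul _ _).trans (h3.const_smul c)

/-- `g` is the trace on `S ⊆ ∂U` of `v ∈ H¹(U; ℝ^d)`. The trace operator is the extension by
continuity, from `H¹(U; ℝ^d)` to `L²(S; ℝ^d)`, of the restriction `φ|_U ↦ φ|_S` of smooth functions:
its graph is the closure in `H¹(U; ℝ^d) × L²(S; ℝ^d)` of the graph of the restriction. -/
def IsTrace {d : ℕ} {U : Set (Vec d)} (S : Set (Vec d)) (v : H1 U) (g : L2Surf S) : Prop :=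
  ((v : PairSpace U), g) ∈ (smoothGraph U S).topologicalClosure

/-- `H^{1/2}(Γ; ℝ^d)`, for `Γ = ∂Ω`: the image of the trace operator of `H¹(Ω; ℝ^d)` on `Γ`. -/
def HHalf {d : ℕ} (Ω : Set (Vec d)) : Submodule ℝ (L2Surf (frontier Ω)) where
  carrier := {g | ∃ v : H1 Ω, IsTrace (frontier Ω) v g}
  zero_mem' := ⟨0, (smoothGraph Ω (frontier Ω)).topologicalClosure.zero_mem⟩
  add_mem' := by
    rintro a b ⟨v, hv⟩ ⟨w, hw⟩
    exact ⟨v + w, (smoothGraph Ω (frontier Ω)).topologicalClosure.add_mem hv hw⟩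
  smul_mem' := by
    rintro c a ⟨v, hv⟩
    exact ⟨c • v, (smoothGraph Ω (frontier Ω)).topologicalClosure.smul_mem c hv⟩

/-- `H^{-1/2}(Γ; ℝ^d)`: the continuous linear functionals on `H^{1/2}(Γ; ℝ^d)`, which carries the
quotient norm `inf {‖v‖_{H¹(Ω)} | v has trace ψ}`. The pairing `⟨ℓ, ψ⟩` is `(ℓ : Module.Dual ..) ψ`. -/
def HNegHalf {d : ℕ} (Ω : Set (Vec d)) : Submodule ℝ (Module.Dual ℝ (HHalf Ω)) where
  carrier := {ℓ | ∃ C : ℝ, 0 ≤ C ∧ ∀ (v : H1 Ω) (ψ : HHalf Ω),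
    IsTrace (frontier Ω) v (ψ : L2Surf (frontier Ω)) → |ℓ ψ| ≤ C * ‖v‖}
  zero_mem' := ⟨0, le_rfl, fun v ψ _ => by simp⟩
  add_mem' := by
    rintro a b ⟨C, hC, h⟩ ⟨D, hD, k⟩
    refine ⟨C + D, add_nonneg hC hD, fun v ψ hv => ?_⟩
    calc |(a + b) ψ| ≤ |a ψ| + |b ψ| := abs_add_le _ _
      _ ≤ C * ‖v‖ + D * ‖v‖ := add_le_add (h v ψ hv) (k v ψ hv)
      _ = (C + D) * ‖v‖ := by ring
  smul_mem' := by
    rintro c a ⟨C, hC, h⟩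
    refine ⟨|c| * C, mul_nonneg (abs_nonneg c) hC, fun v ψ hv => ?_⟩
    have := mul_le_mul_of_nonneg_left (h v ψ hv) (abs_nonneg c)
    simpa [abs_mul, mul_assoc] using this

/-- The annular domain `Ω \ closure B`. -/
abbrev annulus {d : ℕ} (Ω B : Set (Vec d)) : Set (Vec d) := Ω \ closure B

/-- `v ∈ H¹(Ω \ closure B; ℝ^d)` has trace `g` on `Γ = ∂Ω` and trace `0` on `∂B`. -/
def HasBoundaryData {d : ℕ} (Ω B : Set (Vec d)) (v : H1 (annulus Ω B)) (g : L2Surf (frontier Ω)) :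
    Prop :=
  IsTrace (frontier Ω) v g ∧ IsTrace (frontier B) v 0

/-- `v` is a weak solution in `H¹(Ω \ closure B; ℝ^d)` of `-Δ v = 0` in `Ω \ closure B`, `v = 0` on
`∂B`, `v = g` on `Γ`. -/
def IsDirichletSolution {d : ℕ} (Ω B : Set (Vec d)) (g : HHalf Ω) (v : H1 (annulus Ω B)) : Prop :=
  HasBoundaryData Ω B v g ∧
    ∀ φ : H1 (annulus Ω B), HasBoundaryData Ω B φ 0 → dirichletForm v φ = 0

/-- `ℓ ∈ H^{-1/2}(Γ; ℝ^d)` is the weak normal derivative `∇v · ν` on `Γ` of a weakly harmonic `v`: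
Green's formula `⟨ℓ, ψ⟩ = ∫ ∇v : ∇w dx` holds for every `w ∈ H¹(Ω \ closure B; ℝ^d)` with `w = ψ` on
`Γ` and `w = 0` on `∂B`. -/
def IsNormalDerivative {d : ℕ} (Ω B : Set (Vec d)) (v : H1 (annulus Ω B)) (ℓ : HNegHalf Ω) : Prop :=
  ∀ (ψ : HHalf Ω) (w : H1 (annulus Ω B)), HasBoundaryData Ω B w ψ →
    (ℓ : Module.Dual ℝ (HHalf Ω)) ψ = dirichletForm v w

/-- `ℓ = ∇v · ν` on `Γ`, where `v` solves the Dirichlet problem with datum `g`. -/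
def IsDtN {d : ℕ} (Ω B : Set (Vec d)) (g : HHalf Ω) (ℓ : HNegHalf Ω) : Prop :=
  ∃ v : H1 (annulus Ω B), IsDirichletSolution Ω B g v ∧ IsNormalDerivative Ω B v ℓ

open Classical in
/-- The Dirichlet-to-Neumann map `Λ : H^{1/2}(Γ; ℝ^d) → H^{-1/2}(Γ; ℝ^d)`. -/
def dtn {d : ℕ} (Ω B : Set (Vec d)) (g : HHalf Ω) : HNegHalf Ω :=
  if h : ∃ ℓ, IsDtN Ω B g ℓ then h.choose else 0

/-- The form `a^ε(φ, ψ) = ⟨(ε Λ + I) φ, ψ⟩ = ε ⟨Λ φ, ψ⟩ + (φ, ψ)_{L²(Γ)}`. -/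
def aForm {d : ℕ} (Ω B : Set (Vec d)) (ε : ℝ) (φ ψ : HHalf Ω) : ℝ :=
  ε * (dtn Ω B φ : Module.Dual ℝ (HHalf Ω)) ψ
    + inner ℝ (φ : L2Surf (frontier Ω)) (ψ : L2Surf (frontier Ω))

/-- `gε` solves `(ε Λ + I) gε = g` weakly: `a^ε(gε, φ) = (g, φ)_{L²(Γ)}` for all `φ`. -/
def IsRobinApproximation {d : ℕ} (Ω B : Set (Vec d)) (ε : ℝ) (g gε : HHalf Ω) : Prop :=
  ∀ φ : HHalf Ω, aForm Ω B ε gε φ =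
    inner ℝ (g : L2Surf (frontier Ω)) (φ : L2Surf (frontier Ω))

/-- `ℓ ∈ H^{-1/2}(Γ; ℝ^d)` is the function `h ∈ L²(Γ; ℝ^d)`, under the embedding
`h ↦ (h, ·)_{L²(Γ)}` of `L²` in `H^{-1/2}`. -/
def IsL2Function {d : ℕ} {Ω : Set (Vec d)} (ℓ : HNegHalf Ω) (h : L2Surf (frontier Ω)) : Prop :=
  ∀ ψ : HHalf Ω, (ℓ : Module.Dual ℝ (HHalf Ω)) ψ = inner ℝ h (ψ : L2Surf (frontier Ω))

end CMM

end

/-!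
Write `U = Ω \ closure B` and `Γ = ∂Ω`. Everything rests on one coercivity estimate,
`norm_sq_le_of_hasBoundaryData`: if `v ∈ H¹(U)` has trace `h` on `Γ` and trace `0` on `∂B`, then
`‖v‖² ≤ C (‖∇v‖² + ‖h‖²)`. No trace theorem is required for it. A trace is a limit of restrictions
of smooth functions `φ`, and for smooth `φ` one follows the ray from `x ∈ U` in a fixed coordinate
direction to the point `y` where it leaves `U`. The fundamental theorem of calculus on that segment
bounds `|φ x|²` by `|φ y|²` and an integral of `|∇φ|²` over points of `U`. Integrating in `x`, the
term with `|φ y|²` is at most a multiple of the surface integral of `|φ|²`, because projection along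
the rays does not increase Hausdorff measure (`map_exitPoint_le`). Each `x` exits either through `Γ`
or through `∂B`, and on the two parts of `U` one uses the approximations that realise the
corresponding trace.

Multiplication by a cutoff function that vanishes near `closure B` and equals `1` on `Γ` identifies
`H^{1/2}(Γ)` with the traces on `Γ` of functions in `H¹(U)` that vanish on `∂B`
(`exists_hasBoundaryData`, `mem_HHalf_of_isTrace`). By the coercivity estimate both variational
problems are orthogonal projections onto complete subspaces (`exists_mem_inner_sub_eq_zero`): the
Dirichlet problem projects `∇w`, and the regularised problem projects `(0, g)` onto the pairs
`(√ε ∇φ, φ|_Γ)`. The pairing `⟨Λ g, ψ⟩` is the Dirichlet form of the solution against any admissible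
extension of `ψ`, and so `Λ` is monotone (`dtn_apply_sub_mono`). Uniqueness of `gε` follows, and so
does the estimate: for `e = gε - g` the equation gives
`‖e‖² = -ε ⟨Λ gε, e⟩ ≤ -ε ⟨Λ g, e⟩ ≤ ε ‖Λ g‖ ‖e‖`.
-/

open scoped Pointwise

namespace CMM

/-! ### The exit point of a bounded open set in a given direction -/

section ExitPoint

variable {E : Type*} [NormedAddCommGroup E] [NormedSpace ℝ E]

/-- The first time `t ≥ 0` at which the ray `x + t • e` is outside `U`; it is `0` for `x ∉ U`. -/
noncomputable def exitTime (U : Set E) (e x : E) : ℝ := sInf {t : ℝ | 0 ≤ t ∧ x + t • e ∉ U}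

/-- The point at which the ray from `x` in the direction `e` leaves `U`. -/
noncomputable def exitPoint (U : Set E) (e x : E) : E := x + exitTime U e x • e

variable {U : Set E} {e : E} {R : ℝ}

lemma exitTime_nonneg (x : E) : 0 ≤ exitTime U e x := Real.sInf_nonneg fun _ ht => ht.1

/-- A chord of a ball of radius `R` has length at most `2 * R`. -/
lemma le_of_mem_of_mem (he : ‖e‖ = 1) (hR : U ⊆ Metric.closedBall 0 R) {x : E} (hx : x ∈ U)
    {t : ℝ} (ht : x + t • e ∈ U) : t ≤ 2 * R := by
  have h1 := mem_closedBall_zero_iff.1 (hR hx)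
  have h2 := mem_closedBall_zero_iff.1 (hR ht)
  have h3 : ‖t • e‖ ≤ ‖x + t • e‖ + ‖x‖ := by
    simpa using norm_sub_le (x + t • e) x
  rw [norm_smul, he, mul_one] at h3
  linarith [Real.le_norm_self t]

lemma exitTime_set_nonempty (he : ‖e‖ = 1) (hR : U ⊆ Metric.closedBall 0 R) (x : E) :
    {t : ℝ | 0 ≤ t ∧ x + t • e ∉ U}.Nonempty := by
  by_cases hx : x ∈ U
  · have h0 : 0 ≤ R := (norm_nonneg x).trans (mem_closedBall_zero_iff.1 (hR hx))
    exact ⟨2 * R + 1, by linarith, fun h => by linarith [le_of_mem_of_mem he hR hx h]⟩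
  · exact ⟨0, le_rfl, by simpa using hx⟩

lemma exitPoint_notMem (hU : IsOpen U) (he : ‖e‖ = 1) (hR : U ⊆ Metric.closedBall 0 R) (x : E) :
    exitPoint U e x ∉ U := by
  have hcl : IsClosed {t : ℝ | 0 ≤ t ∧ x + t • e ∉ U} :=
    isClosed_Ici.inter
      (hU.isClosed_compl.preimage (by fun_prop : Continuous fun t : ℝ => x + t • e))
  exact (hcl.csInf_mem (exitTime_set_nonempty he hR x) ⟨0, fun t ht => ht.1⟩).2

lemma mem_of_lt_exitTime {x : E} {t : ℝ} (h0 : 0 ≤ t) (ht : t < exitTime U e x) :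
    x + t • e ∈ U := by
  by_contra h
  exact not_le.2 ht (csInf_le ⟨0, fun t ht => ht.1⟩ ⟨h0, h⟩)

lemma exitTime_le (he : ‖e‖ = 1) (hR : U ⊆ Metric.closedBall 0 R) {x : E} (hx : x ∈ U) :
    exitTime U e x ≤ 2 * R := by
  refine le_of_forall_lt fun s hs => ?_
  have h0 : 0 ≤ R := (norm_nonneg x).trans (mem_closedBall_zero_iff.1 (hR hx))
  rcases lt_or_ge s 0 with h | h
  · linarith
  · obtain ⟨s', h1, h2⟩ := exists_between hs
    exact h1.trans_le (le_of_mem_of_mem he hR hx (mem_of_lt_exitTime (h.trans h1.le) h2))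

lemma exitPoint_mem_frontier (hU : IsOpen U) (he : ‖e‖ = 1) (hR : U ⊆ Metric.closedBall 0 R)
    {x : E} (hx : x ∈ U) : exitPoint U e x ∈ frontier U := by
  have hy := exitPoint_notMem hU he hR x
  have hpos : 0 < exitTime U e x := by
    refine (exitTime_nonneg x).lt_of_ne fun h => hy ?_
    simpa [exitPoint, ← h] using hx
  rw [hU.frontier_eq]
  refine ⟨?_, hy⟩
  have hc : Tendsto (fun t : ℝ => x + t • e) (𝓝[<] exitTime U e x) (𝓝 (exitPoint U e x)) :=
    ((by fun_prop : Continuous fun t : ℝ => x + t • e).tendsto _).mono_left nhdsWithin_le_nhds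
  refine mem_closure_of_tendsto hc ?_
  filter_upwards [Ioo_mem_nhdsLT hpos] with t ht
  exact mem_of_lt_exitTime ht.1.le ht.2

lemma measurable_exitTime [MeasurableSpace E] [BorelSpace E] (hU : IsOpen U) (he : ‖e‖ = 1)
    (hR : U ⊆ Metric.closedBall 0 R) : Measurable (exitTime U e) := by
  refine measurable_of_Iic fun a => ?_
  -- `{x | exitTime x ≤ a}` is the complement of `U` swept along `-e` for times in `[0, a]`, the sum
  -- of a closed and a compact set.
  have hcl : IsClosed (Uᶜ + (fun t : ℝ => -(t • e)) '' Set.Icc 0 a) :=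
    hU.isClosed_compl.add_right_of_isCompact (isCompact_Icc.image (by fun_prop))
  convert hcl.measurableSet using 1
  ext x
  simp only [Set.mem_preimage, Set.mem_Iic, Set.mem_add, Set.mem_image, Set.mem_compl_iff]
  constructor
  · intro h
    exact ⟨exitPoint U e x, exitPoint_notMem hU he hR x, _,
      ⟨exitTime U e x, ⟨exitTime_nonneg x, h⟩, rfl⟩, by simp [exitPoint]⟩
  · rintro ⟨y, hy, _, ⟨t, ht, rfl⟩, rfl⟩
    have hmem : t ∈ {s : ℝ | 0 ≤ s ∧ y + -(t • e) + s • e ∉ U} := ⟨ht.1, by simpa using hy⟩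
    exact (csInf_le ⟨0, fun s hs => hs.1⟩ hmem).trans ht.2

lemma measurable_exitPoint [MeasurableSpace E] [BorelSpace E] [SecondCountableTopology E]
    (hU : IsOpen U) (he : ‖e‖ = 1)
    (hR : U ⊆ Metric.closedBall 0 R) : Measurable (exitPoint U e) :=
  measurable_id.add ((measurable_exitTime hU he hR).smul_const e)

end ExitPoint

/-! ### Surface measure and the exit point -/

/-- The orthogonal projection of `ℝ^(n+1)` onto `ℝ^n` along the coordinate `0`. -/
def dropFirst {n : ℕ} (x : Vec (n + 1)) : Vec n := WithLp.toLp 2 fun i => x i.succ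

lemma lipschitzWith_dropFirst {n : ℕ} : LipschitzWith 1 (dropFirst (n := n)) := by
  refine LipschitzWith.of_dist_le_mul fun x y => ?_
  rw [NNReal.coe_one, one_mul, EuclideanSpace.dist_eq, EuclideanSpace.dist_eq]
  refine Real.sqrt_le_sqrt ?_
  rw [Fin.sum_univ_succ]
  exact le_add_of_nonneg_left (sq_nonneg _)

lemma dropFirst_add_smul {n : ℕ} (x : Vec (n + 1)) (t : ℝ) :
    dropFirst (x + t • basisVec 0) = dropFirst x := by
  ext i
  simp [dropFirst]

lemma volume_dropFirst_image_le {n : ℕ} (A : Set (Vec (n + 1))) :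
    volume (dropFirst '' A) ≤ (μHE[n] : Measure (Vec (n + 1))) A := by
  rw [← EuclideanSpace.euclideanHausdorffMeasure_eq_volume, Measure.euclideanHausdorffMeasure_def,
    Measure.euclideanHausdorffMeasure_def, Measure.smul_apply, Measure.smul_apply]
  gcongr
  simpa using lipschitzWith_dropFirst.hausdorffMeasure_image_le (d := n) (Nat.cast_nonneg n) A

/-- No measurability is needed, since the splitting `ℝ^(n+1) ≃ ℝ × ℝ^n` is a measurable
equivalence. -/
lemma volume_cylinder {n : ℕ} (I : Set ℝ) (A : Set (Vec n)) :
    volume {x : Vec (n + 1) | x 0 ∈ I ∧ dropFirst x ∈ A} = volume I * volume A := by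
  have h1 := (EuclideanSpace.volume_preserving_symm_measurableEquiv_toLp (Fin (n + 1))).symm
  have h2 := (volume_preserving_piFinSuccAbove (fun _ : Fin (n + 1) => ℝ) 0).symm
  have h3 := (EuclideanSpace.volume_preserving_symm_measurableEquiv_toLp (Fin n)).symm
  rw [← h1.measure_preimage_equiv, ← h2.measure_preimage_equiv, ← h3.measure_preimage_equiv A,
    ← Measure.prod_prod]
  rfl

/-- The image of the Lebesgue measure under the exit map, restricted to the points that exit
through `S`, is at most a multiple of the surface measure. The points that exit through `T ∩ S`
lie in the cylinder of height `2 * R` over the projection of `T ∩ S`, and projecting does not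
increase the Hausdorff measure. -/
lemma map_exitPoint_le {n : ℕ} {U S : Set (Vec (n + 1))} {R : ℝ} (hU : IsOpen U)
    (hR : U ⊆ Metric.closedBall 0 R) :
    Measure.map (exitPoint U (basisVec 0))
      (volume.restrict (U ∩ exitPoint U (basisVec 0) ⁻¹' S)) ≤
      ENNReal.ofReal (2 * R) • surfaceMeasure S := by
  have he : ‖(basisVec 0 : Vec (n + 1))‖ = 1 := by simp
  have hm := measurable_exitPoint hU he hR
  refine Measure.le_iff.2 fun T hT => ?_
  rw [Measure.map_apply hm hT, Measure.restrict_apply (hm hT), Measure.smul_apply, surfaceMeasure,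
    Measure.restrict_apply hT, smul_eq_mul]
  calc volume (exitPoint U (basisVec 0) ⁻¹' T ∩ (U ∩ exitPoint U (basisVec 0) ⁻¹' S))
      ≤ volume {x : Vec (n + 1) | x 0 ∈ Set.Icc (-R) R ∧ dropFirst x ∈ dropFirst '' (T ∩ S)} := by
        refine measure_mono ?_
        rintro x ⟨hxT, hxU, hxS⟩
        refine ⟨?_, exitPoint U (basisVec 0) x, ⟨hxT, hxS⟩, dropFirst_add_smul _ _⟩
        exact abs_le.1 ((PiLp.norm_apply_le x 0).trans (mem_closedBall_zero_iff.1 (hR hxU)))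
    _ = ENNReal.ofReal (2 * R) * volume (dropFirst '' (T ∩ S)) := by
        rw [volume_cylinder, Real.volume_Icc]; ring_nf
    _ ≤ _ := by gcongr; exact volume_dropFirst_image_le _

/-! ### Integrals along segments up to the exit point -/

lemma sq_lintegral_le {α : Type*} [MeasurableSpace α] {μ : Measure α} {f : α → ℝ≥0∞}
    (hf : AEMeasurable f μ) : (∫⁻ x, f x ∂μ) ^ 2 ≤ μ Set.univ * ∫⁻ x, f x ^ 2 ∂μ := by
  have h := ENNReal.lintegral_mul_le_Lp_mul_Lq μ Real.HolderConjugate.two_two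
    (aemeasurable_const (b := (1 : ℝ≥0∞))) hf
  simp only [Pi.mul_apply, one_mul, ENNReal.one_rpow, lintegral_one] at h
  calc _ ≤ _ := pow_le_pow_left' h 2
    _ = _ := by
      rw [mul_pow, ← ENNReal.rpow_natCast, ← ENNReal.rpow_natCast, ← ENNReal.rpow_mul,
        ← ENNReal.rpow_mul]
      simp

lemma sq_add_le (a b : ℝ≥0∞) : (a + b) ^ 2 ≤ 2 * a ^ 2 + 2 * b ^ 2 := by
  have h := ENNReal.rpow_add_le_mul_rpow_add_rpow a b (p := 2) (by norm_num)
  norm_num at h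
  rwa [mul_add] at h

/-- The fundamental theorem of calculus on the segment from `x` to its exit point, followed by the
Cauchy-Schwarz inequality. The segment stays in `U`, so the derivative is used on `U` only. -/
lemma enorm_sq_le_exitPoint {E F : Type*} [NormedAddCommGroup E] [NormedSpace ℝ E]
    [NormedAddCommGroup F] [NormedSpace ℝ F] [CompleteSpace F] {U : Set E} {e : E} {R : ℝ}
    (he : ‖e‖ = 1) (hR : U ⊆ Metric.closedBall 0 R) {φ : E → F} (hφ : ContDiff ℝ 1 φ) {x : E}
    (hx : x ∈ U) :
    ‖φ x‖ₑ ^ 2 ≤ 2 * ‖φ (exitPoint U e x)‖ₑ ^ 2 + 2 * (ENNReal.ofReal (2 * R) *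
      ∫⁻ t in Set.Icc 0 (2 * R), U.indicator (fun y => ‖fderiv ℝ φ y e‖ₑ ^ 2) (x + t • e)) := by
  set T := exitTime U e x with hT
  have hT0 : 0 ≤ T := exitTime_nonneg x
  have hTL : T ≤ 2 * R := exitTime_le he hR hx
  have hcont : Continuous fun t : ℝ => fderiv ℝ φ (x + t • e) e :=
    ((hφ.continuous_fderiv (by simp)).comp (by fun_prop)).clm_apply continuous_const
  have hder : ∀ t : ℝ, HasDerivAt (fun t : ℝ => φ (x + t • e)) (fderiv ℝ φ (x + t • e) e) t := by
    intro t
    have h1 : HasDerivAt (fun t : ℝ => x + t • e) e t := by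
      simpa using ((hasDerivAt_id t).smul_const e).const_add x
    exact ((hφ.differentiable (by simp) _).hasFDerivAt).comp_hasDerivAt t h1
  have hftc := intervalIntegral.integral_eq_sub_of_hasDerivAt (a := 0) (b := T)
    (fun t _ => hder t) (hcont.intervalIntegrable _ _)
  rw [intervalIntegral.integral_of_le hT0] at hftc
  have h1 : ‖φ x‖ₑ ≤ ‖φ (exitPoint U e x)‖ₑ + ∫⁻ t in Set.Ioc 0 T, ‖fderiv ℝ φ (x + t • e) e‖ₑ := by
    have h2 : φ x = φ (exitPoint U e x) - ∫ t in Set.Ioc 0 T, fderiv ℝ φ (x + t • e) e := by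
      rw [hftc]; simp [exitPoint, hT]
    calc ‖φ x‖ₑ ≤ ‖φ (exitPoint U e x)‖ₑ + ‖∫ t in Set.Ioc 0 T, fderiv ℝ φ (x + t • e) e‖ₑ := by
          conv_lhs => rw [h2]
          exact enorm_sub_le
      _ ≤ _ := by gcongr; exact enorm_integral_le_lintegral_enorm _
  have h3 : (∫⁻ t in Set.Ioc 0 T, ‖fderiv ℝ φ (x + t • e) e‖ₑ) ^ 2 ≤ ENNReal.ofReal (2 * R) *
      ∫⁻ t in Set.Icc 0 (2 * R), U.indicator (fun y => ‖fderiv ℝ φ y e‖ₑ ^ 2) (x + t • e) := by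
    refine (sq_lintegral_le hcont.enorm.measurable.aemeasurable).trans ?_
    rw [Measure.restrict_apply_univ, Real.volume_Ioc, sub_zero]
    refine mul_le_mul' (ENNReal.ofReal_le_ofReal hTL) ?_
    -- The exit point itself is not in `U`, so the endpoint is removed.
    rw [setLIntegral_congr Ioo_ae_eq_Ioc.symm]
    calc _ = ∫⁻ t in Set.Ioo 0 T, U.indicator (fun y => ‖fderiv ℝ φ y e‖ₑ ^ 2) (x + t • e) := by
          refine setLIntegral_congr_fun measurableSet_Ioo fun t ht => ?_
          rw [Set.indicator_of_mem (mem_of_lt_exitTime ht.1.le ht.2)]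
      _ ≤ _ := lintegral_mono_set
          (Set.Ioo_subset_Icc_self.trans (Set.Icc_subset_Icc_right hTL))
  calc _ ≤ _ := pow_le_pow_left' h1 2
    _ ≤ _ := sq_add_le _ _
    _ ≤ _ := by gcongr

lemma lintegral_translates {E : Type*} [NormedAddCommGroup E] [NormedSpace ℝ E]
    [MeasurableSpace E] [BorelSpace E] [SecondCountableTopology E] (μ : Measure E) [SFinite μ]
    [μ.IsAddRightInvariant] {G : E → ℝ≥0∞} (hG : Measurable G) (e : E) (I : Set ℝ) :
    ∫⁻ x, (∫⁻ t in I, G (x + t • e)) ∂μ = volume I * ∫⁻ x, G x ∂μ := by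
  rw [lintegral_lintegral_swap]
  · simp_rw [lintegral_add_right_eq_self]
    rw [lintegral_const, Measure.restrict_apply_univ, mul_comm]
  · exact (hG.comp (by fun_prop)).aemeasurable

/-- The Friedrichs inequality for smooth functions, on the part of `U` from which rays exit
through `S`: there the values of `φ` on `S` alone control `φ`. -/
lemma lintegral_enorm_sq_le {n : ℕ} {U S : Set (Vec (n + 1))} {R : ℝ} (hU : IsOpen U)
    (hR : U ⊆ Metric.closedBall 0 R) (hS : MeasurableSet S) {φ : Vec (n + 1) → Vec (n + 1)}
    (hφ : ContDiff ℝ 1 φ) :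
    ∫⁻ x in U ∩ exitPoint U (basisVec 0) ⁻¹' S, ‖φ x‖ₑ ^ 2 ≤
      2 * (ENNReal.ofReal (2 * R) * ∫⁻ x, ‖φ x‖ₑ ^ 2 ∂surfaceMeasure S) +
      2 * (ENNReal.ofReal (2 * R) ^ 2 * ∫⁻ x in U, ‖fderiv ℝ φ x (basisVec 0)‖ₑ ^ 2) := by
  have he : ‖(basisVec 0 : Vec (n + 1))‖ = 1 := by simp
  have hm := measurable_exitPoint hU he hR
  set V := U ∩ exitPoint U (basisVec 0) ⁻¹' S with hV
  have hVm : MeasurableSet V := hU.measurableSet.inter (hm hS)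
  set G : Vec (n + 1) → ℝ≥0∞ := U.indicator fun y => ‖fderiv ℝ φ y (basisVec 0)‖ₑ ^ 2 with hG
  have hfm : Measurable fun y => ‖fderiv ℝ φ y (basisVec 0)‖ₑ ^ 2 :=
    (((hφ.continuous_fderiv (by simp)).clm_apply continuous_const).enorm.measurable).pow_const 2
  have hGm : Measurable G := hfm.indicator hU.measurableSet
  have hφm : Measurable fun y => ‖φ y‖ₑ ^ 2 := hφ.continuous.enorm.measurable.pow_const 2
  calc ∫⁻ x in V, ‖φ x‖ₑ ^ 2
      ≤ ∫⁻ x in V, (2 * ‖φ (exitPoint U (basisVec 0) x)‖ₑ ^ 2 + 2 * (ENNReal.ofReal (2 * R) *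
          ∫⁻ t in Set.Icc 0 (2 * R), G (x + t • basisVec 0))) :=
        setLIntegral_mono' hVm fun x hx => enorm_sq_le_exitPoint he hR hφ hx.1
    _ = 2 * (∫⁻ x in V, ‖φ (exitPoint U (basisVec 0) x)‖ₑ ^ 2) + 2 * (ENNReal.ofReal (2 * R) *
          ∫⁻ x in V, ∫⁻ t in Set.Icc 0 (2 * R), G (x + t • basisVec 0)) := by
        have hφm' : Measurable fun x => ‖φ (exitPoint U (basisVec 0) x)‖ₑ ^ 2 := hφm.comp hm
        rw [lintegral_add_left (hφm'.const_mul 2), lintegral_const_mul _ hφm',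
          lintegral_const_mul' _ _ (by simp), lintegral_const_mul' _ _ ENNReal.ofReal_ne_top]
    _ ≤ _ := by
        refine add_le_add (mul_le_mul_right ?_ _) (mul_le_mul_right ?_ _)
        · calc ∫⁻ x in V, ‖φ (exitPoint U (basisVec 0) x)‖ₑ ^ 2
              = ∫⁻ y, ‖φ y‖ₑ ^ 2 ∂Measure.map (exitPoint U (basisVec 0)) (volume.restrict V) :=
                (lintegral_map hφm hm).symm
            _ ≤ ∫⁻ y, ‖φ y‖ₑ ^ 2 ∂(ENNReal.ofReal (2 * R) • surfaceMeasure S) :=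
                lintegral_mono' (map_exitPoint_le hU hR) le_rfl
            _ = _ := by rw [lintegral_smul_measure, smul_eq_mul]
        · rw [sq, mul_assoc]
          refine mul_le_mul_right ?_ _
          calc _ ≤ ∫⁻ x, ∫⁻ t in Set.Icc 0 (2 * R), G (x + t • basisVec 0) :=
                setLIntegral_le_lintegral _ _
            _ = _ := by
                rw [lintegral_translates _ hGm, Real.volume_Icc, sub_zero, hG,
                  lintegral_indicator hU.measurableSet]

/-! ### The Friedrichs inequality -/

lemma enorm_sq_eq_lintegral {α F : Type*} [MeasurableSpace α] {μ : Measure α}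
    [NormedAddCommGroup F] (f : Lp F 2 μ) : ‖f‖ₑ ^ 2 = ∫⁻ x, ‖f x‖ₑ ^ 2 ∂μ := by
  rw [Lp.enorm_def]
  have h := eLpNorm_nnreal_pow_eq_lintegral (f := f) (μ := μ) (p := 2) two_ne_zero
  simpa using h

lemma enorm_sq_restrict {α F : Type*} [MeasurableSpace α] {μ : Measure α}
    [NormedAddCommGroup F] [NormedSpace ℝ F] {U V : Set α} (hV : MeasurableSet V)
    (v : Lp F 2 (μ.restrict U)) :
    ‖LpToLpRestrictCLM α F ℝ (μ.restrict U) 2 V v‖ₑ ^ 2 = ∫⁻ x in U ∩ V, ‖v x‖ₑ ^ 2 ∂μ := by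
  rw [enorm_sq_eq_lintegral, Set.inter_comm, ← Measure.restrict_restrict hV]
  refine lintegral_congr_ae ?_
  filter_upwards [LpToLpRestrictCLM_coeFn (p := 2) ℝ V v] with x hx
  rw [hx]

lemma isClosed_enorm_sq_le {X A B C : Type*} [TopologicalSpace X] [NormedAddCommGroup A]
    [NormedAddCommGroup B] [NormedAddCommGroup C] {f : X → A} {g : X → B} {h : X → C}
    (hf : Continuous f) (hg : Continuous g) (hh : Continuous h) {b c : ℝ≥0∞} (hb : b ≠ ⊤)
    (hc : c ≠ ⊤) : IsClosed {x | ‖f x‖ₑ ^ 2 ≤ b * ‖g x‖ₑ ^ 2 + c * ‖h x‖ₑ ^ 2} :=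
  isClosed_le ((ENNReal.continuous_pow 2).comp hf.enorm)
    (((ENNReal.continuous_const_mul hb).comp ((ENNReal.continuous_pow 2).comp hg.enorm)).add
    ((ENNReal.continuous_const_mul hc).comp ((ENNReal.continuous_pow 2).comp hh.enorm)))

lemma enorm_sq_le_of_mem_smoothGraph {n : ℕ} {U S : Set (Vec (n + 1))} {R : ℝ}
    (hU : IsOpen U) (hR : U ⊆ Metric.closedBall 0 R) (hS : MeasurableSet S) {p : PairSpace U}
    {h : L2Surf S} (hp : (p, h) ∈ smoothGraph U S) :
    ∫⁻ x in U ∩ exitPoint U (basisVec 0) ⁻¹' S, ‖p.fst x‖ₑ ^ 2 ≤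
      2 * (ENNReal.ofReal (2 * R) * ‖h‖ₑ ^ 2) +
        2 * (ENNReal.ofReal (2 * R) ^ 2 * ‖p.snd 0‖ₑ ^ 2) := by
  obtain ⟨φ, hφ, h1, h2, h3⟩ := hp
  have e1 : ∫⁻ x in U ∩ exitPoint U (basisVec 0) ⁻¹' S, ‖p.fst x‖ₑ ^ 2 =
      ∫⁻ x in U ∩ exitPoint U (basisVec 0) ⁻¹' S, ‖φ x‖ₑ ^ 2 := by
    refine lintegral_congr_ae ?_
    filter_upwards [ae_restrict_of_ae_restrict_of_subset Set.inter_subset_left h1] with x hx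
    rw [hx]
  have e2 : ‖h‖ₑ ^ 2 = ∫⁻ x, ‖φ x‖ₑ ^ 2 ∂surfaceMeasure S := by
    rw [enorm_sq_eq_lintegral]
    refine lintegral_congr_ae ?_
    filter_upwards [h3] with x hx
    rw [hx]
  have e3 : ‖p.snd 0‖ₑ ^ 2 = ∫⁻ x in U, ‖fderiv ℝ φ x (basisVec 0)‖ₑ ^ 2 := by
    rw [enorm_sq_eq_lintegral]
    refine lintegral_congr_ae ?_
    filter_upwards [h2 0] with x hx
    rw [hx]
  rw [e1, e2, e3]
  exact lintegral_enorm_sq_le hU hR hS (hφ.of_le (by simp))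

/-- Both sides of the inequality for smooth functions are continuous on `H¹ × L²(S)`, so it passes
to the closure of the graph of the restriction. -/
lemma enorm_sq_le_of_mem_closure_smoothGraph {n : ℕ} {U S : Set (Vec (n + 1))} {R : ℝ}
    (hU : IsOpen U) (hR : U ⊆ Metric.closedBall 0 R) (hS : MeasurableSet S) {p : PairSpace U}
    {h : L2Surf S} (hp : (p, h) ∈ (smoothGraph U S).topologicalClosure) :
    ∫⁻ x in U ∩ exitPoint U (basisVec 0) ⁻¹' S, ‖p.fst x‖ₑ ^ 2 ≤
      2 * (ENNReal.ofReal (2 * R) * ‖h‖ₑ ^ 2) +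
        2 * (ENNReal.ofReal (2 * R) ^ 2 * ‖p.snd 0‖ₑ ^ 2) := by
  have hV : MeasurableSet (exitPoint U (basisVec 0) ⁻¹' S) :=
    measurable_exitPoint hU (by simp) hR hS
  have hcl := isClosed_enorm_sq_le
    (f := fun q : PairSpace U × L2Surf S => LpToLpRestrictCLM (Vec (n + 1)) (Vec (n + 1)) ℝ
      (volume.restrict U) 2 (exitPoint U (basisVec 0) ⁻¹' S) q.1.fst)
    (g := fun q => q.2) (h := fun q => q.1.snd 0)
    ((LpToLpRestrictCLM (Vec (n + 1)) (Vec (n + 1)) ℝ (volume.restrict U) 2 _).continuous.comp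
      ((WithLp.continuous_fst _ _ _).comp continuous_fst)) continuous_snd
    ((PiLp.continuous_apply 2 _ 0).comp ((WithLp.continuous_snd _ _ _).comp continuous_fst))
    (b := 2 * ENNReal.ofReal (2 * R)) (c := 2 * ENNReal.ofReal (2 * R) ^ 2)
    (by finiteness) (by finiteness)
  rw [← mul_assoc, ← mul_assoc, ← enorm_sq_restrict hV]
  have hmem := closure_minimal (s := (smoothGraph U S : Set (PairSpace U × L2Surf S)))
    (fun q hq => by
      rw [Set.mem_ofPred_eq, enorm_sq_restrict hV, mul_assoc, mul_assoc]
      exact enorm_sq_le_of_mem_smoothGraph hU hR hS hq) hcl hp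
  exact hmem

/-- **Friedrichs inequality** for a function with trace `h` on `S` and trace `0` on `S'`, where
`S` and `S'` cover the boundary. The two traces may come from different smooth approximations: one
is used at the points that exit through `S`, the other at those that exit through `S'`. -/
lemma norm_sq_le_of_mem_closure_smoothGraph {n : ℕ} {U S S' : Set (Vec (n + 1))} (hU : IsOpen U)
    (hb : Bornology.IsBounded U) (hS : MeasurableSet S) (hS' : MeasurableSet S')
    (hfr : frontier U ⊆ S ∪ S') :
    ∃ C : ℝ, ∀ (p : PairSpace U) (h : L2Surf S),
      (p, h) ∈ (smoothGraph U S).topologicalClosure →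
      (p, (0 : L2Surf S')) ∈ (smoothGraph U S').topologicalClosure →
      ‖p‖ ^ 2 ≤ C * (‖p.snd‖ ^ 2 + ‖h‖ ^ 2) := by
  obtain ⟨R, hR0, hR⟩ := hb.subset_closedBall_lt 0 0
  refine ⟨1 + 4 * R + 16 * R ^ 2, fun p h hp hp' => ?_⟩
  have h1 := enorm_sq_le_of_mem_closure_smoothGraph hU hR hS hp
  have h2 := enorm_sq_le_of_mem_closure_smoothGraph hU hR hS' hp'
  have h3 : ‖p.fst‖ₑ ^ 2 ≤ (∫⁻ x in U ∩ exitPoint U (basisVec 0) ⁻¹' S, ‖p.fst x‖ₑ ^ 2) +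
      ∫⁻ x in U ∩ exitPoint U (basisVec 0) ⁻¹' S', ‖p.fst x‖ₑ ^ 2 := by
    rw [enorm_sq_eq_lintegral]
    refine (lintegral_mono_set fun x hx => ?_).trans (lintegral_union_le _ _ _)
    rw [← Set.inter_union_distrib_left]
    exact ⟨hx, hfr (exitPoint_mem_frontier hU (by simp) hR hx)⟩
  have h4 : ‖p.fst‖ ^ 2 ≤ 2 * (2 * R * ‖h‖ ^ 2) + 2 * ((2 * R) ^ 2 * ‖p.snd 0‖ ^ 2) +
      2 * ((2 * R) ^ 2 * ‖p.snd 0‖ ^ 2) := by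
    have h5 := h3.trans (add_le_add h1 h2)
    lift R to ℝ≥0 using hR0.le
    have h6 : ENNReal.ofReal (2 * (R : ℝ)) = ((2 * R : ℝ≥0) : ℝ≥0∞) := by
      rw [← ENNReal.ofReal_coe_nnreal]; simp
    rw [h6] at h5
    simp only [enorm_eq_nnnorm, nnnorm_zero] at h5
    have h8 : ‖p.fst‖₊ ^ 2 ≤ 2 * (2 * R * ‖h‖₊ ^ 2) + 2 * ((2 * R) ^ 2 * ‖p.snd 0‖₊ ^ 2) +
        (2 * (2 * R * 0 ^ 2) + 2 * ((2 * R) ^ 2 * ‖p.snd 0‖₊ ^ 2)) := by exact_mod_cast h5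
    have h9 := NNReal.coe_le_coe.2 h8
    push_cast at h9
    linarith
  have h7 : ‖p.snd 0‖ ^ 2 ≤ ‖p.snd‖ ^ 2 :=
    pow_le_pow_left₀ (norm_nonneg _) (PiLp.norm_apply_le p.snd 0) 2
  rw [WithLp.prod_norm_sq_eq_of_L2]
  nlinarith [mul_le_mul_of_nonneg_left h7 (sq_nonneg R), mul_nonneg hR0.le (sq_nonneg ‖p.snd‖),
    sq_nonneg ‖h‖, mul_nonneg (sq_nonneg R) (sq_nonneg ‖h‖)]

/-! ### Multiplication by a cutoff function -/

variable {d : ℕ}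

/-- Multiplication by a bounded continuous function, followed by extension by zero from `U₁` and
restriction to `U₂`, is a bounded operator on `L²`. -/
lemma exists_mulCLM {U₁ U₂ : Set (Vec d)} (hU₁ : MeasurableSet U₁) {ρ : Vec d → ℝ}
    (hρ : Continuous ρ) {C : ℝ} (hC : ∀ x, ‖ρ x‖ ≤ C) :
    ∃ M : L2Vol U₁ →L[ℝ] L2Vol U₂, ∀ v,
      M v =ᵐ[(volume : Measure (Vec d)).restrict U₂] U₁.indicator fun x => ρ x • v x := by
  have hle : ∀ v : L2Vol U₁, eLpNorm (fun x => ρ x • v x) 2 (volume.restrict U₁) ≤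
      ENNReal.ofReal C * eLpNorm v 2 (volume.restrict U₁) := fun v =>
    eLpNorm_le_mul_eLpNorm_of_ae_le_mul (Eventually.of_forall fun x => by
      rw [norm_smul]; gcongr; exact hC x) 2
  have hmem : ∀ v : L2Vol U₁, MemLp (fun x => ρ x • v x) 2 (volume.restrict U₁) := fun v =>
    ⟨hρ.aestronglyMeasurable.smul (Lp.aestronglyMeasurable v),
      (hle v).trans_lt (ENNReal.mul_lt_top ENNReal.ofReal_lt_top (Lp.eLpNorm_lt_top v))⟩
  have hind : ∀ v : L2Vol U₁,
      MemLp (U₁.indicator fun x => ρ x • v x) 2 (volume.restrict U₂) := fun v =>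
    ((memLp_indicator_iff_restrict hU₁).2 (hmem v)).restrict U₂
  let M₀ : L2Vol U₁ →ₗ[ℝ] L2Vol U₂ :=
    { toFun := fun v => (hind v).toLp _
      map_add' := fun v w => by
        rw [← MemLp.toLp_add]
        refine MemLp.toLp_congr _ _ (ae_restrict_of_ae ?_)
        filter_upwards [(ae_restrict_iff' hU₁).1 (Lp.coeFn_add v w)] with x hx
        by_cases hxU : x ∈ U₁
        · simp only [Pi.add_apply, Set.indicator_of_mem hxU]
          rw [hx hxU, Pi.add_apply, smul_add]
        · simp [hxU]
      map_smul' := fun c v => by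
        rw [RingHom.id_apply, ← MemLp.toLp_const_smul]
        refine MemLp.toLp_congr _ _ (ae_restrict_of_ae ?_)
        filter_upwards [(ae_restrict_iff' hU₁).1 (Lp.coeFn_smul c v)] with x hx
        by_cases hxU : x ∈ U₁
        · simp [hxU, hx hxU, smul_comm c]
        · simp [hxU] }
  refine ⟨M₀.mkContinuous C fun v => ?_, fun v => (hind v).coeFn_toLp⟩
  have hC0 : 0 ≤ C := (norm_nonneg _).trans (hC 0)
  change ‖(hind v).toLp _‖ ≤ _
  rw [Lp.norm_toLp, Lp.norm_def, ← ENNReal.toReal_ofReal hC0, ← ENNReal.toReal_mul]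
  refine ENNReal.toReal_mono
    (ENNReal.mul_ne_top ENNReal.ofReal_ne_top (Lp.eLpNorm_ne_top v)) ?_
  calc _ ≤ eLpNorm (U₁.indicator fun x => ρ x • v x) 2 volume :=
        eLpNorm_mono_measure _ Measure.restrict_le_self
    _ = _ := eLpNorm_indicator_eq_eLpNorm_restrict hU₁
    _ ≤ _ := by simpa [ENNReal.toReal_ofReal hC0] using hle v

/-- A smooth function that is bounded together with its first derivative. -/
structure IsCutoff (η : Vec d → ℝ) : Prop where
  contDiff : ContDiff ℝ ∞ η
  bounded : ∃ C, ∀ x, ‖η x‖ ≤ C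
  bounded_fderiv : ∃ C, ∀ x, ‖fderiv ℝ η x‖ ≤ C

/-- The derivative of the cutoff function is bounded since it vanishes on `F`, outside a bounded
set. -/
lemma exists_cutoff {K F : Set (Vec d)} (hK : IsClosed K) (hF : IsClosed F)
    (hKF : Disjoint K F) (hb : Bornology.IsBounded Fᶜ) :
    ∃ η : Vec d → ℝ, IsCutoff η ∧ (∀ x ∈ K, η x = 0 ∧ fderiv ℝ η x = 0) ∧ ∀ x ∈ F, η x = 1 := by
  obtain ⟨f, h0, h1, h01⟩ := exists_contMDiffMap_zero_one_nhds_of_isClosed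
    (modelWithCornersSelf ℝ (Vec d)) (n := ⊤) hK hF hKF
  have hf : ContDiff ℝ ∞ f := f.contMDiff.contDiff
  have hx0 : ∀ x ∈ K, (f : Vec d → ℝ) =ᶠ[𝓝 x] fun _ => 0 := fun x hx =>
    eventually_nhdsSet_iff_forall.1 h0 x hx
  have hx1 : ∀ x ∈ F, (f : Vec d → ℝ) =ᶠ[𝓝 x] fun _ => 1 := fun x hx =>
    eventually_nhdsSet_iff_forall.1 h1 x hx
  refine ⟨f, ⟨hf, ⟨1, fun x => ?_⟩, ?_⟩, fun x hx => ⟨(hx0 x hx).self_of_nhds, ?_⟩,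
    fun x hx => (hx1 x hx).self_of_nhds⟩
  · rw [Real.norm_eq_abs, abs_of_nonneg (h01 x).1]
    exact (h01 x).2
  · have hc : HasCompactSupport (fderiv ℝ f) := by
      refine HasCompactSupport.of_support_subset_isCompact hb.isCompact_closure fun x hx => ?_
      refine subset_closure fun hxF => hx ?_
      rw [(hx1 x hxF).fderiv_eq, fderiv_fun_const, Pi.zero_apply]
    exact hc.exists_bound_of_continuous (hf.continuous_fderiv (by simp))
  · rw [(hx0 x hx).fderiv_eq, fderiv_fun_const, Pi.zero_apply]

/-- `M` is the map `(v, ∇v) ↦ (η v, ∇(η v))` from pairs on `U₁` to pairs on `U₂`, where functions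
on `U₁` are extended by zero. -/
structure IsCutoffMap {U₁ U₂ : Set (Vec d)} (η : Vec d → ℝ)
    (M : PairSpace U₁ →L[ℝ] PairSpace U₂) : Prop where
  fst : ∀ p, (M p).fst =ᵐ[(volume : Measure (Vec d)).restrict U₂]
    U₁.indicator fun x => η x • p.fst x
  snd : ∀ p j, (M p).snd j =ᵐ[(volume : Measure (Vec d)).restrict U₂]
    U₁.indicator fun x => η x • p.snd j x + fderiv ℝ η x (basisVec j) • p.fst x

lemma exists_cutoffCLM {U₁ U₂ : Set (Vec d)} (hU₁ : MeasurableSet U₁) {η : Vec d → ℝ}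
    (hη : IsCutoff η) :
    ∃ M : PairSpace U₁ →L[ℝ] PairSpace U₂, IsCutoffMap η M := by
  obtain ⟨C, hC⟩ := hη.bounded
  obtain ⟨D, hD⟩ := hη.bounded_fderiv
  obtain ⟨A, hA⟩ := exists_mulCLM (U₂ := U₂) hU₁ hη.contDiff.continuous hC
  have hB : ∀ j : Fin d, ∃ M : L2Vol U₁ →L[ℝ] L2Vol U₂, ∀ v,
      M v =ᵐ[(volume : Measure (Vec d)).restrict U₂]
        U₁.indicator fun x => fderiv ℝ η x (basisVec j) • v x := fun j =>
    exists_mulCLM hU₁ (continuous_partial hη.contDiff j) (C := D)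
      fun x => (((fderiv ℝ η x).le_opNorm _).trans (by simp)).trans (hD x)
  choose B hB using hB
  let fstL : PairSpace U₁ →L[ℝ] L2Vol U₁ := WithLp.fstL 2 ℝ _ _
  let sndL : PairSpace U₁ →L[ℝ] PiLp 2 (fun _ : Fin d => L2Vol U₁) := WithLp.sndL 2 ℝ _ _
  let M : PairSpace U₁ →L[ℝ] PairSpace U₂ :=
    (WithLp.prodContinuousLinearEquiv 2 ℝ _ _).symm.toContinuousLinearMap ∘L
      ((A ∘L fstL).prod ((PiLp.continuousLinearEquiv 2 ℝ _).symm.toContinuousLinearMap ∘L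
        ContinuousLinearMap.pi fun j =>
          A ∘L PiLp.proj 2 (fun _ : Fin d => L2Vol U₁) j ∘L sndL + B j ∘L fstL))
  refine ⟨M, fun p => hA p.fst, fun p j => ?_⟩
  have h : (M p).snd j = A (p.snd j) + B j p.fst := rfl
  rw [h]
  filter_upwards [Lp.coeFn_add (A (p.snd j)) (B j p.fst), hA (p.snd j), hB j p.fst]
    with x h1 h2 h3
  rw [h1, Pi.add_apply, h2, h3]
  by_cases hx : x ∈ U₁ <;> simp [hx]

/-- Multiplication by `η` respects traces, provided `η` vanishes with its gradient on `U₂ \ U₁`,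
so that `η φ`, for smooth `φ`, is the extension by zero of its restriction to `U₁`. The operator
`N` is multiplication by `η` on the boundary parts. -/
lemma IsCutoffMap.mem_closure_smoothGraph {U₁ U₂ S₁ S₂ : Set (Vec d)} (hU₁ : MeasurableSet U₁)
    (hU₂ : MeasurableSet U₂) {η : Vec d → ℝ}
    (hη : IsCutoff η) (h0 : ∀ x ∈ U₂ \ U₁, η x = 0 ∧ fderiv ℝ η x = 0)
    {M : PairSpace U₁ →L[ℝ] PairSpace U₂} (hM : IsCutoffMap η M)
    {N : L2Surf S₁ →L[ℝ] L2Surf S₂} (hN : ∀ (h : L2Surf S₁) (φ : Vec d → Vec d),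
      h =ᵐ[surfaceMeasure S₁] φ → N h =ᵐ[surfaceMeasure S₂] fun x => η x • φ x)
    {p : PairSpace U₁} {h : L2Surf S₁} (hp : (p, h) ∈ (smoothGraph U₁ S₁).topologicalClosure) :
    (M p, N h) ∈ (smoothGraph U₂ S₂).topologicalClosure := by
  refine map_mem_closure (f := Prod.map M N) (M.continuous.prodMap N.continuous) hp ?_
  rintro ⟨p, h⟩ ⟨φ, hφ, h1, h2, h3⟩
  refine ⟨fun x => η x • φ x, hη.contDiff.smul hφ, ?_, fun j => ?_, hN h φ h3⟩
  · refine (hM.fst p).trans ?_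
    filter_upwards [ae_restrict_of_ae ((ae_restrict_iff' hU₁).1 h1), ae_restrict_mem hU₂]
      with x hx hxU
    by_cases hx1 : x ∈ U₁
    · simp [hx1, hx hx1]
    · simp [hx1, (h0 x ⟨hxU, hx1⟩).1]
  · refine (hM.snd p j).trans ?_
    filter_upwards [ae_restrict_of_ae ((ae_restrict_iff' hU₁).1 h1),
      ae_restrict_of_ae ((ae_restrict_iff' hU₁).1 (h2 j)), ae_restrict_mem hU₂]
      with x hx hx' hxU
    rw [fderiv_fun_smul (hη.contDiff.differentiable (by simp) x) (hφ.differentiable (by simp) x)]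
    by_cases hx1 : x ∈ U₁
    · simp [hx1, hx hx1, hx' hx1]
    · simp [hx1, (h0 x ⟨hxU, hx1⟩).1, (h0 x ⟨hxU, hx1⟩).2]

/-! ### Closedness of the Sobolev space -/

lemma isClosed_isWeakPartial (U : Set (Vec d)) (j : Fin d) :
    IsClosed {q : L2Vol U × L2Vol U | IsWeakPartial U j q.1 q.2} := by
  have hcont : ∀ f : Vec d → ℝ, Continuous f → HasCompactSupport f →
      Continuous fun v : L2Vol U => ∫ x in U, f x • v x := by
    intro f hf hc
    have hm : MemLp f 2 ((volume : Measure (Vec d)).restrict U) := hf.memLp_of_hasCompactSupport hc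
    refine (((ContinuousLinearMap.lsmul ℝ ℝ : ℝ →L[ℝ] Vec d →L[ℝ] Vec d).lpPairing
      (volume.restrict U) 2 2) (hm.toLp f)).continuous.congr fun v => ?_
    rw [ContinuousLinearMap.lpPairing_eq_integral]
    refine integral_congr_ae ?_
    filter_upwards [hm.coeFn_toLp] with x hx
    rw [hx]
    rfl
  simp only [IsWeakPartial, Set.ofPred_forall]
  refine isClosed_iInter fun φ => isClosed_iInter fun hφ => isClosed_iInter fun hc =>
    isClosed_iInter fun _ => isClosed_eq ?_ ?_
  · exact (hcont _ (continuous_partial hφ j) (compact_partial hc j)).comp continuous_fst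
  · exact ((hcont _ hφ.continuous hc).comp continuous_snd).neg

lemma isClosed_H1 (U : Set (Vec d)) : IsClosed (H1 U : Set (PairSpace U)) := by
  have : (H1 U : Set (PairSpace U)) = ⋂ j, {p | IsWeakPartial U j p.fst (p.snd j)} := by
    ext p; simp only [Set.mem_iInter]; rfl
  rw [this]
  exact isClosed_iInter fun j => (isClosed_isWeakPartial U j).preimage
    (by fun_prop : Continuous fun p : PairSpace U => (p.fst, p.snd j))

/-- Classical partial derivatives of smooth functions are weak ones, and `H¹` is closed. -/
lemma mem_H1_of_mem_closure_smoothGraph {U S : Set (Vec d)} {p : PairSpace U} {h : L2Surf S}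
    (hp : (p, h) ∈ (smoothGraph U S).topologicalClosure) : p ∈ H1 U := by
  refine closure_minimal (t := Prod.fst ⁻¹' (H1 U : Set (PairSpace U))) ?_
    ((isClosed_H1 U).preimage continuous_fst) hp
  rintro ⟨p, h⟩ ⟨φ, hφ, h1, h2, -⟩ j ψ hψ hc hs
  have hφ' : Continuous fun x => fderiv ℝ φ x (basisVec j) :=
    (hφ.continuous_fderiv (by simp)).clm_apply continuous_const
  have hz : ∀ x ∉ U, ψ x = 0 := fun x hx => image_eq_zero_of_notMem_tsupport fun h => hx (hs h)
  have hz' : ∀ x ∉ U, fderiv ℝ ψ x (basisVec j) = 0 := fun x hx => by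
    rw [image_eq_zero_of_notMem_tsupport (f := fderiv ℝ ψ)
      fun h => hx (hs (tsupport_fderiv_subset ℝ h))]
    rfl
  calc ∫ x in U, fderiv ℝ ψ x (basisVec j) • p.fst x
      = ∫ x in U, fderiv ℝ ψ x (basisVec j) • φ x := integral_congr_ae <| by
        filter_upwards [h1] with x hx
        exact congrArg _ hx
    _ = ∫ x, fderiv ℝ ψ x (basisVec j) • φ x :=
        setIntegral_eq_integral_of_forall_compl_eq_zero fun x hx => by rw [hz' x hx, zero_smul]
    _ = -∫ x, ψ x • fderiv ℝ φ x (basisVec j) := by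
        rw [integral_smul_fderiv_eq_neg_fderiv_smul_of_integrable, neg_neg]
        · exact ((continuous_partial hψ j).smul hφ.continuous).integrable_of_hasCompactSupport
            (compact_partial hc j).smul_right
        · exact (hψ.continuous.smul hφ').integrable_of_hasCompactSupport hc.smul_right
        · exact (hψ.continuous.smul hφ.continuous).integrable_of_hasCompactSupport hc.smul_right
        · exact fun x _ => hψ.differentiable (by simp) x
        · exact fun x _ => hφ.differentiable (by simp) x
    _ = -∫ x in U, ψ x • fderiv ℝ φ x (basisVec j) := by
        rw [setIntegral_eq_integral_of_forall_compl_eq_zero fun x hx => by rw [hz x hx, zero_smul]]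
    _ = -∫ x in U, ψ x • p.snd j x := by
        refine congrArg _ (integral_congr_ae ?_)
        filter_upwards [h2 j] with x hx
        exact congrArg _ hx.symm

/-! ### Hilbert space preliminaries -/

/-- Least squares: the point `T x` is the orthogonal projection of `y` onto the subspace `T(W)`,
which is complete because `T` is bounded below on `W`. -/
lemma exists_mem_inner_sub_eq_zero {E G : Type*} [NormedAddCommGroup E] [NormedSpace ℝ E]
    [CompleteSpace E] [NormedAddCommGroup G] [InnerProductSpace ℝ G] (T : E →L[ℝ] G)
    {W : Submodule ℝ E} (hW : IsClosed (W : Set E)) {c : ℝ} (hT : ∀ x ∈ W, ‖x‖ ^ 2 ≤ c * ‖T x‖ ^ 2)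
    (y : G) : ∃ x ∈ W, ∀ x' ∈ W, inner ℝ (T x - y) (T x') = 0 := by
  have : CompleteSpace W := hW.completeSpace_coe
  have hanti : AntilipschitzWith (NNReal.sqrt c.toNNReal) (T ∘L W.subtypeL) := by
    refine AddMonoidHomClass.antilipschitz_of_bound _ fun x => ?_
    rw [Real.coe_sqrt, ← Real.sqrt_sq (norm_nonneg x),
      ← Real.sqrt_sq (norm_nonneg ((T ∘L W.subtypeL) x)), ← Real.sqrt_mul' _ (sq_nonneg _)]
    exact Real.sqrt_le_sqrt ((hT x x.2).trans
      (mul_le_mul_of_nonneg_right (Real.le_coe_toNNReal c) (sq_nonneg _)))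
  have hcompl : IsComplete (W.map (T : E →ₗ[ℝ] G) : Set G) := by
    have h := hanti.isComplete_range (T ∘L W.subtypeL).uniformContinuous
    rwa [ContinuousLinearMap.coe_comp, Set.range_comp, Submodule.coe_subtypeL,
      Submodule.coe_subtype, Subtype.range_coe] at h
  obtain ⟨z, ⟨x, hx, rfl⟩, hz⟩ := Submodule.exists_norm_eq_iInf_of_complete_subspace _ hcompl y
  refine ⟨x, hx, fun x' hx' => ?_⟩
  have h := (Submodule.norm_eq_iInf_iff_inner_eq_zero _ (Submodule.mem_map_of_mem hx)).1 hz (T x')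
    (Submodule.mem_map_of_mem hx')
  rw [← neg_sub, inner_neg_left, neg_eq_zero]
  exact h

section GraphWithZero

variable {P Q Q' : Type*} [NormedAddCommGroup P] [NormedSpace ℝ P] [NormedAddCommGroup Q]
  [NormedSpace ℝ Q] [NormedAddCommGroup Q'] [NormedSpace ℝ Q']

/-- The pairs `(p, h) ∈ K` such that `(p, 0) ∈ K'`. -/
def graphWithZero (K : Submodule ℝ (P × Q)) (K' : Submodule ℝ (P × Q')) : Submodule ℝ (P × Q) where
  carrier := {q | q ∈ K ∧ (q.1, (0 : Q')) ∈ K'}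
  zero_mem' := ⟨K.zero_mem, K'.zero_mem⟩
  add_mem' := fun ha hb => ⟨K.add_mem ha.1 hb.1, by simpa using K'.add_mem ha.2 hb.2⟩
  smul_mem' := fun c _ ha => ⟨K.smul_mem c ha.1, by simpa using K'.smul_mem c ha.2⟩

lemma mem_graphWithZero {K : Submodule ℝ (P × Q)} {K' : Submodule ℝ (P × Q')} {q : P × Q} :
    q ∈ graphWithZero K K' ↔ q ∈ K ∧ (q.1, (0 : Q')) ∈ K' := Iff.rfl

lemma isClosed_graphWithZero {K : Submodule ℝ (P × Q)} {K' : Submodule ℝ (P × Q')}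
    (hK : IsClosed (K : Set (P × Q))) (hK' : IsClosed (K' : Set (P × Q'))) :
    IsClosed (graphWithZero K K' : Set (P × Q)) :=
  hK.inter (hK'.preimage (continuous_fst.prodMk continuous_const))

end GraphWithZero

/-! ### Boundary data on the annular domain -/

variable {Ω B : Set (Vec d)}

lemma dirichletForm_eq_inner {U : Set (Vec d)} (v w : H1 U) :
    dirichletForm v w = inner ℝ (grad v) (grad w) := (PiLp.inner_apply _ _).symm

lemma HasBoundaryData.sub {v w : H1 (annulus Ω B)} {g h : L2Surf (frontier Ω)}
    (hv : HasBoundaryData Ω B v g) (hw : HasBoundaryData Ω B w h) :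
    HasBoundaryData Ω B (v - w) (g - h) := by
  refine ⟨Submodule.sub_mem _ hv.1 hw.1, ?_⟩
  have h0 := Submodule.sub_mem _ hv.2 hw.2
  rwa [Prod.mk_sub_mk, sub_zero] at h0

lemma HasBoundaryData.add {v w : H1 (annulus Ω B)} {g h : L2Surf (frontier Ω)}
    (hv : HasBoundaryData Ω B v g) (hw : HasBoundaryData Ω B w h) :
    HasBoundaryData Ω B (v + w) (g + h) := by
  refine ⟨Submodule.add_mem _ hv.1 hw.1, ?_⟩
  have h0 := Submodule.add_mem _ hv.2 hw.2
  rwa [Prod.mk_add_mk, add_zero] at h0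

lemma HasBoundaryData.smul (c : ℝ) {v : H1 (annulus Ω B)} {g : L2Surf (frontier Ω)}
    (hv : HasBoundaryData Ω B v g) : HasBoundaryData Ω B (c • v) (c • g) := by
  refine ⟨Submodule.smul_mem _ c hv.1, ?_⟩
  have h0 := Submodule.smul_mem _ c hv.2
  rwa [Prod.smul_mk, smul_zero] at h0

lemma frontier_annulus_subset : frontier (annulus Ω B) ⊆ frontier Ω ∪ frontier B := by
  rw [annulus, Set.sdiff_eq]
  refine (frontier_inter_subset _ _).trans (Set.union_subset_union Set.inter_subset_left ?_)
  rw [frontier_compl]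
  exact Set.inter_subset_right.trans frontier_closure_subset

lemma isOpen_annulus (hΩ : IsOpen Ω) : IsOpen (annulus Ω B) := hΩ.sdiff isClosed_closure

/-- The coercivity estimate behind both variational problems. -/
lemma norm_sq_le_of_hasBoundaryData (hd : d ≠ 0) (hΩ : IsOpen Ω) (hb : Bornology.IsBounded Ω) :
    ∃ C : ℝ, ∀ (v : H1 (annulus Ω B)) (h : L2Surf (frontier Ω)), HasBoundaryData Ω B v h →
      ‖v‖ ^ 2 ≤ C * (‖grad v‖ ^ 2 + ‖h‖ ^ 2) := by
  obtain ⟨n, rfl⟩ := Nat.exists_eq_succ_of_ne_zero hd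
  obtain ⟨C, hC⟩ := norm_sq_le_of_mem_closure_smoothGraph (isOpen_annulus (B := B) hΩ)
    (hb.subset Set.sdiff_subset)
    isClosed_frontier.measurableSet isClosed_frontier.measurableSet frontier_annulus_subset
  exact ⟨C, fun v h hv => hC v h hv.1 hv.2⟩

lemma exists_annulus_cutoff (hΩ : IsOpen Ω) (hb : Bornology.IsBounded Ω) (hBΩ : closure B ⊆ Ω) :
    ∃ η : Vec d → ℝ, IsCutoff η ∧ (∀ x ∈ closure B, η x = 0 ∧ fderiv ℝ η x = 0) ∧
      ∀ x ∈ frontier Ω, η x = 1 := by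
  obtain ⟨η, h, h0, h1⟩ := exists_cutoff isClosed_closure hΩ.isClosed_compl
    (Set.disjoint_compl_right_iff_subset.2 hBΩ) (by rwa [compl_compl])
  exact ⟨η, h, h0, fun x hx => h1 x (by rw [hΩ.frontier_eq] at hx; exact hx.2)⟩

lemma ae_eq_cutoff_smul {η : Vec d → ℝ} {S : Set (Vec d)} (hS : IsClosed S)
    (h1 : ∀ x ∈ S, η x = 1) (h : L2Surf S) (φ : Vec d → Vec d) (hφ : h =ᵐ[surfaceMeasure S] φ) :
    h =ᵐ[surfaceMeasure S] fun x => η x • φ x := by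
  filter_upwards [hφ, ae_restrict_mem hS.measurableSet] with x hx hxS
  rw [hx, h1 x hxS, one_smul]

/-- Multiplying an `H¹(Ω)` extension of `g` by a cutoff function that vanishes near `closure B`
gives an admissible extension on the annular domain, with a bound. -/
lemma exists_hasBoundaryData (hΩ : IsOpen Ω) (hb : Bornology.IsBounded Ω) (hBΩ : closure B ⊆ Ω) :
    ∃ C : ℝ, 0 ≤ C ∧ ∀ (V : H1 Ω) (g : L2Surf (frontier Ω)), IsTrace (frontier Ω) V g →
      ∃ w : H1 (annulus Ω B), HasBoundaryData Ω B w g ∧ ‖w‖ ≤ C * ‖V‖ := by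
  obtain ⟨η, hη, h0, h1⟩ := exists_annulus_cutoff hΩ hb hBΩ
  obtain ⟨M, hM⟩ := exists_cutoffCLM (U₂ := annulus Ω B) hΩ.measurableSet hη
  have hU := (isOpen_annulus (B := B) hΩ).measurableSet
  have hdiff : ∀ x ∈ annulus Ω B \ Ω, η x = 0 ∧ fderiv ℝ η x = 0 := fun x hx => absurd hx.1.1 hx.2
  refine ⟨‖M‖, norm_nonneg _, fun V g hV => ?_⟩
  have hΓ := IsCutoffMap.mem_closure_smoothGraph hΩ.measurableSet hU hη hdiff hM
    (N := ContinuousLinearMap.id ℝ (L2Surf (frontier Ω)))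
    (ae_eq_cutoff_smul isClosed_frontier h1) hV
  rw [ContinuousLinearMap.id_apply] at hΓ
  have hZero := IsCutoffMap.mem_closure_smoothGraph hΩ.measurableSet hU hη hdiff hM
    (N := (0 : L2Surf (frontier Ω) →L[ℝ] L2Surf (frontier B))) (fun h φ _ => by
      refine (Lp.coeFn_zero _ _ _).trans ?_
      filter_upwards [ae_restrict_mem isClosed_frontier.measurableSet] with x hx
      rw [(h0 x (frontier_subset_closure hx)).1, zero_smul, Pi.zero_apply]) hV
  exact ⟨⟨M V, mem_H1_of_mem_closure_smoothGraph hΓ⟩, ⟨hΓ, hZero⟩, M.le_opNorm _⟩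

/-- Conversely to `exists_hasBoundaryData`, a function on the annular domain that is cut off near
`closure B` extends by zero to `Ω` without changing its trace on `∂Ω`. -/
lemma mem_HHalf_of_isTrace (hΩ : IsOpen Ω) (hb : Bornology.IsBounded Ω) (hBΩ : closure B ⊆ Ω)
    {w : H1 (annulus Ω B)} {h : L2Surf (frontier Ω)} (hw : IsTrace (frontier Ω) w h) :
    h ∈ HHalf Ω := by
  obtain ⟨η, hη, h0, h1⟩ := exists_annulus_cutoff hΩ hb hBΩ
  have hU := (isOpen_annulus (B := B) hΩ).measurableSet
  obtain ⟨M, hM⟩ := exists_cutoffCLM (U₂ := Ω) hU hη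
  have hΓ := IsCutoffMap.mem_closure_smoothGraph hU hΩ.measurableSet hη
    (fun x hx => h0 x (by_contra fun h => hx.2 ⟨hx.1, h⟩)) hM
    (N := ContinuousLinearMap.id ℝ (L2Surf (frontier Ω)))
    (ae_eq_cutoff_smul isClosed_frontier h1) hw
  rw [ContinuousLinearMap.id_apply] at hΓ
  exact ⟨⟨M w, mem_H1_of_mem_closure_smoothGraph hΓ⟩, hΓ⟩

/-- The closed subspace of all `(v, h)` such that `v ∈ H¹` has trace `h` on `∂Ω` and trace `0` on
`∂B`. -/
noncomputable def boundaryDataGraph (Ω B : Set (Vec d)) :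
    Submodule ℝ (PairSpace (annulus Ω B) × L2Surf (frontier Ω)) :=
  graphWithZero (smoothGraph (annulus Ω B) (frontier Ω)).topologicalClosure
    (smoothGraph (annulus Ω B) (frontier B)).topologicalClosure

lemma isClosed_boundaryDataGraph :
    IsClosed (boundaryDataGraph Ω B : Set (PairSpace (annulus Ω B) × L2Surf (frontier Ω))) :=
  isClosed_graphWithZero (Submodule.isClosed_topologicalClosure _)
    (Submodule.isClosed_topologicalClosure _)

lemma mem_boundaryDataGraph {v : H1 (annulus Ω B)} {h : L2Surf (frontier Ω)} :
    ((v : PairSpace (annulus Ω B)), h) ∈ boundaryDataGraph Ω B ↔ HasBoundaryData Ω B v h :=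
  mem_graphWithZero

lemma exists_of_mem_boundaryDataGraph {q : PairSpace (annulus Ω B) × L2Surf (frontier Ω)}
    (hq : q ∈ boundaryDataGraph Ω B) :
    ∃ v : H1 (annulus Ω B), q.1 = v ∧ HasBoundaryData Ω B v q.2 := by
  have h := mem_graphWithZero.1 hq
  exact ⟨⟨q.1, mem_H1_of_mem_closure_smoothGraph h.1⟩, rfl, h⟩

/-! ### The Dirichlet form and the Dirichlet problem -/

lemma dirichletForm_sub_left {U : Set (Vec d)} (u v w : H1 U) :
    dirichletForm (u - v) w = dirichletForm u w - dirichletForm v w := by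
  simp only [dirichletForm_eq_inner]
  exact inner_sub_left _ _ _

lemma dirichletForm_sub_right {U : Set (Vec d)} (u v w : H1 U) :
    dirichletForm u (v - w) = dirichletForm u v - dirichletForm u w := by
  simp only [dirichletForm_eq_inner]
  exact inner_sub_right _ _ _

lemma dirichletForm_add_right {U : Set (Vec d)} (u v w : H1 U) :
    dirichletForm u (v + w) = dirichletForm u v + dirichletForm u w := by
  simp only [dirichletForm_eq_inner]
  exact inner_add_right _ _ _

lemma dirichletForm_smul_right {U : Set (Vec d)} (c : ℝ) (u v : H1 U) :
    dirichletForm u (c • v) = c * dirichletForm u v := by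
  simp only [dirichletForm_eq_inner]
  exact real_inner_smul_right _ _ _

lemma dirichletForm_self {U : Set (Vec d)} (v : H1 U) : dirichletForm v v = ‖grad v‖ ^ 2 := by
  rw [dirichletForm_eq_inner, real_inner_self_eq_norm_sq]

lemma abs_dirichletForm_le {U : Set (Vec d)} (v w : H1 U) :
    |dirichletForm v w| ≤ ‖grad v‖ * ‖w‖ := by
  rw [dirichletForm_eq_inner]
  refine (abs_real_inner_le_norm _ _).trans ?_
  gcongr
  exact WithLp.norm_snd_le _ (w : PairSpace U)

lemma HasBoundaryData.eq_zero (hd : d ≠ 0) (hΩ : IsOpen Ω) (hb : Bornology.IsBounded Ω)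
    {v : H1 (annulus Ω B)} (hv : HasBoundaryData Ω B v 0) (h : dirichletForm v v = 0) : v = 0 := by
  obtain ⟨C, hC⟩ := norm_sq_le_of_hasBoundaryData (B := B) hd hΩ hb
  have h1 := hC v 0 hv
  rw [dirichletForm_self] at h
  rw [h, norm_zero] at h1
  have h2 : ‖v‖ ^ 2 = 0 := le_antisymm (by linarith) (sq_nonneg _)
  exact norm_eq_zero.1 (pow_eq_zero_iff two_ne_zero |>.1 h2)

lemma IsDirichletSolution.unique (hd : d ≠ 0) (hΩ : IsOpen Ω) (hb : Bornology.IsBounded Ω)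
    {g : HHalf Ω} {v v' : H1 (annulus Ω B)} (hv : IsDirichletSolution Ω B g v)
    (hv' : IsDirichletSolution Ω B g v') : v = v' := by
  have h0 := hv.1.sub hv'.1
  rw [sub_self] at h0
  refine sub_eq_zero.1 (h0.eq_zero hd hΩ hb ?_)
  rw [dirichletForm_sub_left, hv.2 _ h0, hv'.2 _ h0, sub_zero]

/-- The orthogonal projection, for the Dirichlet form, of `w` onto the functions with zero
boundary data. -/
lemma exists_dirichletForm_sub_eq_zero (hd : d ≠ 0) (hΩ : IsOpen Ω) (hb : Bornology.IsBounded Ω)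
    (w : H1 (annulus Ω B)) : ∃ u : H1 (annulus Ω B), HasBoundaryData Ω B u 0 ∧
      ∀ φ : H1 (annulus Ω B), HasBoundaryData Ω B φ 0 → dirichletForm (u - w) φ = 0 := by
  obtain ⟨C, hC⟩ := norm_sq_le_of_hasBoundaryData (B := B) hd hΩ hb
  let T : PairSpace (annulus Ω B) × L2Surf (frontier Ω) →L[ℝ]
      PiLp 2 (fun _ : Fin d => L2Vol (annulus Ω B)) :=
    WithLp.sndL 2 ℝ _ _ ∘L ContinuousLinearMap.fst ℝ _ _
  let W := boundaryDataGraph Ω B ⊓ (ContinuousLinearMap.snd ℝ (PairSpace (annulus Ω B))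
    (L2Surf (frontier Ω))).ker
  have hW : IsClosed (W : Set (PairSpace (annulus Ω B) × L2Surf (frontier Ω))) :=
    isClosed_boundaryDataGraph.inter (ContinuousLinearMap.isClosed_ker _)
  have hWmem : ∀ q ∈ W, ∃ v : H1 (annulus Ω B), q = ((v : PairSpace (annulus Ω B)), 0) ∧
      HasBoundaryData Ω B v 0 := by
    rintro ⟨p, h⟩ ⟨h1, h2⟩
    obtain rfl : h = 0 := h2
    obtain ⟨v, hv, hv'⟩ := exists_of_mem_boundaryDataGraph h1
    exact ⟨v, Prod.ext hv rfl, hv'⟩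
  have hT : ∀ q ∈ W, ‖q‖ ^ 2 ≤ C * ‖T q‖ ^ 2 := by
    intro q hq
    obtain ⟨v, rfl, hv⟩ := hWmem q hq
    have h := hC v 0 hv
    rw [norm_zero, zero_pow two_ne_zero, add_zero] at h
    rw [Prod.norm_mk, norm_zero, max_eq_left (norm_nonneg _)]
    exact h
  obtain ⟨q, hq, hq'⟩ := exists_mem_inner_sub_eq_zero T hW hT (grad w)
  obtain ⟨u, rfl, hu⟩ := hWmem q hq
  refine ⟨u, hu, fun φ hφ => ?_⟩
  rw [dirichletForm_eq_inner]
  exact hq' (φ, 0) ⟨mem_boundaryDataGraph.2 hφ, rfl⟩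

lemma exists_hasBoundaryData_of_HHalf (hΩ : IsOpen Ω) (hb : Bornology.IsBounded Ω)
    (hBΩ : closure B ⊆ Ω) (g : HHalf Ω) :
    ∃ w : H1 (annulus Ω B), HasBoundaryData Ω B w g := by
  obtain ⟨_, _, hC⟩ := exists_hasBoundaryData hΩ hb hBΩ
  obtain ⟨V, hV⟩ := g.2
  obtain ⟨w, hw, _⟩ := hC V g hV
  exact ⟨w, hw⟩

lemma exists_isDirichletSolution (hd : d ≠ 0) (hΩ : IsOpen Ω) (hb : Bornology.IsBounded Ω)
    (hBΩ : closure B ⊆ Ω) (g : HHalf Ω) : ∃ v, IsDirichletSolution Ω B g v := by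
  obtain ⟨w, hw⟩ := exists_hasBoundaryData_of_HHalf hΩ hb hBΩ g
  obtain ⟨u, hu, h⟩ := exists_dirichletForm_sub_eq_zero hd hΩ hb w
  have hwu := hw.sub hu
  rw [sub_zero] at hwu
  refine ⟨w - u, hwu, fun φ hφ => ?_⟩
  have h1 := h φ hφ
  rw [dirichletForm_sub_left] at h1 ⊢
  linarith

/-- The Dirichlet form of a weak solution against `w` depends only on the boundary data of `w`. -/
lemma IsDirichletSolution.dirichletForm_eq {g : HHalf Ω} {v : H1 (annulus Ω B)}
    (hv : IsDirichletSolution Ω B g v) {h : L2Surf (frontier Ω)} {w w' : H1 (annulus Ω B)}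
    (hw : HasBoundaryData Ω B w h) (hw' : HasBoundaryData Ω B w' h) :
    dirichletForm v w = dirichletForm v w' := by
  have h0 := hw.sub hw'
  rw [sub_self] at h0
  have := hv.2 _ h0
  rw [dirichletForm_sub_right] at this
  linarith

lemma IsDirichletSolution.exists_isNormalDerivative (hΩ : IsOpen Ω) (hb : Bornology.IsBounded Ω)
    (hBΩ : closure B ⊆ Ω) {g : HHalf Ω} {v : H1 (annulus Ω B)}
    (hv : IsDirichletSolution Ω B g v) : ∃ ℓ, IsNormalDerivative Ω B v ℓ := by
  -- The choice of extension `w ψ` is not linear, but `dirichletForm v (w ψ)` does not depend on it.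
  choose w hw using exists_hasBoundaryData_of_HHalf hΩ hb hBΩ
  obtain ⟨C, hC0, hC⟩ := exists_hasBoundaryData hΩ hb hBΩ
  let ℓ : Module.Dual ℝ (HHalf Ω) :=
    { toFun := fun ψ => dirichletForm v (w ψ)
      map_add' := fun ψ φ => by
        rw [← dirichletForm_add_right]
        exact hv.dirichletForm_eq (hw (ψ + φ)) ((hw ψ).add (hw φ))
      map_smul' := fun c ψ => by
        rw [RingHom.id_apply, smul_eq_mul, ← dirichletForm_smul_right]
        exact hv.dirichletForm_eq (hw (c • ψ)) ((hw ψ).smul c) }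
  refine ⟨⟨ℓ, ‖grad v‖ * C, by positivity, fun V ψ hV => ?_⟩,
    fun ψ w' hw' => hv.dirichletForm_eq (hw ψ) hw'⟩
  obtain ⟨w', hw', hle⟩ := hC V ψ hV
  calc |dirichletForm v (w ψ)| = |dirichletForm v w'| := by rw [hv.dirichletForm_eq (hw ψ) hw']
    _ ≤ ‖grad v‖ * ‖w'‖ := abs_dirichletForm_le v w'
    _ ≤ ‖grad v‖ * (C * ‖V‖) := by gcongr
    _ = _ := by ring

/-! ### The Dirichlet-to-Neumann map -/

lemma existsUnique_isDtN (hd : d ≠ 0) (hΩ : IsOpen Ω) (hb : Bornology.IsBounded Ω)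
    (hBΩ : closure B ⊆ Ω) (g : HHalf Ω) : ∃! ℓ, IsDtN Ω B g ℓ := by
  obtain ⟨v, hv⟩ := exists_isDirichletSolution hd hΩ hb hBΩ g
  obtain ⟨ℓ, hℓ⟩ := hv.exists_isNormalDerivative hΩ hb hBΩ
  refine ⟨ℓ, ⟨v, hv, hℓ⟩, ?_⟩
  rintro ℓ' ⟨v', hv', hℓ'⟩
  obtain rfl := hv.unique hd hΩ hb hv'
  refine Subtype.ext (LinearMap.ext fun ψ => ?_)
  obtain ⟨w, hw⟩ := exists_hasBoundaryData_of_HHalf hΩ hb hBΩ ψ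
  rw [hℓ ψ w hw, hℓ' ψ w hw]

lemma isDtN_dtn (hd : d ≠ 0) (hΩ : IsOpen Ω) (hb : Bornology.IsBounded Ω)
    (hBΩ : closure B ⊆ Ω) (g : HHalf Ω) : IsDtN Ω B g (dtn Ω B g) := by
  have h := (existsUnique_isDtN hd hΩ hb hBΩ g).exists
  rw [dtn, dif_pos h]
  exact h.choose_spec

/-- Monotonicity of `Λ`: the difference `⟨Λ g - Λ g', g - g'⟩` is the Dirichlet integral of the
difference of the two solutions. -/
lemma dtn_apply_sub_mono (hd : d ≠ 0) (hΩ : IsOpen Ω) (hb : Bornology.IsBounded Ω)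
    (hBΩ : closure B ⊆ Ω) (g g' : HHalf Ω) :
    (dtn Ω B g' : Module.Dual ℝ (HHalf Ω)) (g - g') ≤
      (dtn Ω B g : Module.Dual ℝ (HHalf Ω)) (g - g') := by
  obtain ⟨v, hv, hℓ⟩ := isDtN_dtn hd hΩ hb hBΩ g
  obtain ⟨v', hv', hℓ'⟩ := isDtN_dtn hd hΩ hb hBΩ g'
  have hsub : HasBoundaryData Ω B (v - v') ((g - g' : HHalf Ω) : L2Surf (frontier Ω)) :=
    hv.1.sub hv'.1
  rw [hℓ _ _ hsub, hℓ' _ _ hsub, ← sub_nonneg, ← dirichletForm_sub_left, dirichletForm_self]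
  exact sq_nonneg _

/-! ### The regularised problem -/

/-- The regularised problem in variational form on the annular domain: the boundary values `h` are
an unknown alongside `w`, and `(√ε ∇w, h)` is the orthogonal projection of `(0, g)` onto the
subspace of all `(√ε ∇φ, k)`. -/
lemma exists_robin_weak_solution (hd : d ≠ 0) (hΩ : IsOpen Ω) (hb : Bornology.IsBounded Ω)
    {ε : ℝ} (hε : 0 < ε) (g : L2Surf (frontier Ω)) :
    ∃ (w : H1 (annulus Ω B)) (h : L2Surf (frontier Ω)), HasBoundaryData Ω B w h ∧
      ∀ (φ : H1 (annulus Ω B)) (k : L2Surf (frontier Ω)), HasBoundaryData Ω B φ k →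
        ε * dirichletForm w φ + inner ℝ h k = inner ℝ g k := by
  obtain ⟨C, hC⟩ := norm_sq_le_of_hasBoundaryData (B := B) hd hΩ hb
  let T : PairSpace (annulus Ω B) × L2Surf (frontier Ω) →L[ℝ]
      WithLp 2 (PiLp 2 (fun _ : Fin d => L2Vol (annulus Ω B)) × L2Surf (frontier Ω)) :=
    (WithLp.prodContinuousLinearEquiv 2 ℝ _ _).symm.toContinuousLinearMap ∘L
      ((√ε • WithLp.sndL 2 ℝ (L2Vol (annulus Ω B))
        (PiLp 2 (fun _ : Fin d => L2Vol (annulus Ω B)))).prodMap (ContinuousLinearMap.id ℝ _))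
  have hTapp : ∀ (v : H1 (annulus Ω B)) (h : L2Surf (frontier Ω)),
      T ((v : PairSpace (annulus Ω B)), h) = WithLp.toLp 2 (√ε • grad v, h) := fun _ _ => rfl
  have hTnorm : ∀ (v : H1 (annulus Ω B)) (h : L2Surf (frontier Ω)),
      ‖T ((v : PairSpace (annulus Ω B)), h)‖ ^ 2 = ε * ‖grad v‖ ^ 2 + ‖h‖ ^ 2 := fun v h => by
    rw [hTapp, WithLp.prod_norm_sq_eq_of_L2]
    change ‖√ε • grad v‖ ^ 2 + ‖h‖ ^ 2 = _
    rw [norm_smul, mul_pow, Real.norm_eq_abs, sq_abs, Real.sq_sqrt hε.le]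
  have hT : ∀ q ∈ boundaryDataGraph Ω B, ‖q‖ ^ 2 ≤ (|C| * (ε⁻¹ + 1) + 1) * ‖T q‖ ^ 2 := by
    rintro ⟨p, h⟩ hq
    obtain ⟨v, rfl, hv⟩ := exists_of_mem_boundaryDataGraph hq
    rw [hTnorm]
    have h1 : ‖v‖ ^ 2 ≤ |C| * (‖grad v‖ ^ 2 + ‖h‖ ^ 2) :=
      (hC v h hv).trans (mul_le_mul_of_nonneg_right (le_abs_self C) (by positivity))
    have h2 : ‖grad v‖ ^ 2 + ‖h‖ ^ 2 ≤ (ε⁻¹ + 1) * (ε * ‖grad v‖ ^ 2 + ‖h‖ ^ 2) := by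
      have h3 : (ε⁻¹ + 1) * (ε * ‖grad v‖ ^ 2 + ‖h‖ ^ 2) = ‖grad v‖ ^ 2 + ‖h‖ ^ 2 +
          (ε * ‖grad v‖ ^ 2 + ε⁻¹ * ‖h‖ ^ 2) := by field_simp; ring
      rw [h3]
      exact le_add_of_nonneg_right (by positivity)
    have h4 := mul_le_mul_of_nonneg_left h2 (abs_nonneg C)
    have h5 : 0 ≤ |C| * (ε⁻¹ + 1) * (ε * ‖grad v‖ ^ 2 + ‖h‖ ^ 2) := by positivity
    have h6 : 0 ≤ ε * ‖grad v‖ ^ 2 := by positivity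
    rw [Prod.norm_mk]
    rcases max_choice ‖(v : PairSpace (annulus Ω B))‖ ‖h‖ with hm | hm <;> rw [hm]
    · have h7 : ‖(v : PairSpace (annulus Ω B))‖ = ‖v‖ := rfl
      rw [h7]
      nlinarith [sq_nonneg ‖h‖]
    · nlinarith
  obtain ⟨⟨p, h⟩, hq, hq'⟩ := exists_mem_inner_sub_eq_zero T isClosed_boundaryDataGraph hT
    (WithLp.toLp 2 (0, g))
  obtain ⟨w, rfl, hw⟩ := exists_of_mem_boundaryDataGraph hq
  refine ⟨w, h, hw, fun φ k hφ => ?_⟩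
  have h1 := hq' (φ, k) (mem_boundaryDataGraph.2 hφ)
  rw [inner_sub_left, hTapp, hTapp, WithLp.prod_inner_apply, WithLp.prod_inner_apply] at h1
  simp only [inner_smul_left, inner_smul_right, inner_zero_left, conj_trivial, ← mul_assoc,
    Real.mul_self_sqrt hε.le] at h1
  rw [dirichletForm_eq_inner]
  linarith

/-- Testing the variational equation with zero boundary data shows that `w` solves the Dirichlet
problem with datum `h`, so that the Dirichlet form in the equation is the Dirichlet-to-Neumann map
of `h`. -/
lemma exists_isRobinApproximation (hd : d ≠ 0) (hΩ : IsOpen Ω) (hb : Bornology.IsBounded Ω)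
    (hBΩ : closure B ⊆ Ω) {ε : ℝ} (hε : 0 < ε) (g : HHalf Ω) :
    ∃ gε, IsRobinApproximation Ω B ε g gε := by
  obtain ⟨w, h, hw, hwh⟩ :=
    exists_robin_weak_solution (B := B) hd hΩ hb hε (g : L2Surf (frontier Ω))
  let gε : HHalf Ω := ⟨h, mem_HHalf_of_isTrace hΩ hb hBΩ hw.1⟩
  have hsol : IsDirichletSolution Ω B gε w := by
    refine ⟨hw, fun φ hφ => ?_⟩
    have h1 := hwh φ 0 hφ
    rw [inner_zero_right, inner_zero_right, add_zero] at h1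
    exact (mul_eq_zero.1 h1).resolve_left hε.ne'
  obtain ⟨v, hv, hℓ⟩ := isDtN_dtn hd hΩ hb hBΩ gε
  obtain rfl := hv.unique hd hΩ hb hsol
  refine ⟨gε, fun ψ => ?_⟩
  obtain ⟨φ, hφ⟩ := exists_hasBoundaryData_of_HHalf hΩ hb hBΩ ψ
  rw [aForm, hℓ ψ φ hφ]
  exact hwh φ ψ hφ

lemma IsRobinApproximation.unique (hd : d ≠ 0) (hΩ : IsOpen Ω) (hb : Bornology.IsBounded Ω)
    (hBΩ : closure B ⊆ Ω) {ε : ℝ} (hε : 0 < ε) {g g₁ g₂ : HHalf Ω}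
    (h₁ : IsRobinApproximation Ω B ε g g₁) (h₂ : IsRobinApproximation Ω B ε g g₂) : g₁ = g₂ := by
  have h3 := (h₁ (g₁ - g₂)).trans (h₂ (g₁ - g₂)).symm
  have h4 := mul_le_mul_of_nonneg_left (dtn_apply_sub_mono hd hΩ hb hBΩ g₁ g₂) hε.le
  have h5 : inner ℝ ((g₁ : L2Surf (frontier Ω)) - g₂) (g₁ - g₂) ≤ 0 := by
    rw [inner_sub_left]
    simp only [aForm, Submodule.coe_sub] at h3
    linarith
  exact Subtype.ext (sub_eq_zero.1 (real_inner_self_nonpos.1 h5))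

/-- Testing the equation with `gε - g` and using monotonicity of `Λ` to replace `Λ gε` by `Λ g`.
-/
lemma IsRobinApproximation.norm_sub_le (hd : d ≠ 0) (hΩ : IsOpen Ω) (hb : Bornology.IsBounded Ω)
    (hBΩ : closure B ⊆ Ω) {ε : ℝ} (hε : 0 < ε) {g gε : HHalf Ω}
    (h : IsRobinApproximation Ω B ε g gε) {Λg : L2Surf (frontier Ω)}
    (hΛ : IsL2Function (dtn Ω B g) Λg) :
    ‖(gε : L2Surf (frontier Ω)) - (g : L2Surf (frontier Ω))‖ ≤ ε * ‖Λg‖ := by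
  set e : L2Surf (frontier Ω) := (gε : L2Surf (frontier Ω)) - g with he
  have h1 : ε * (dtn Ω B gε : Module.Dual ℝ (HHalf Ω)) (gε - g) +
      inner ℝ (gε : L2Surf (frontier Ω)) e = inner ℝ (g : L2Surf (frontier Ω)) e := h (gε - g)
  have h2 := mul_le_mul_of_nonneg_left (dtn_apply_sub_mono hd hΩ hb hBΩ gε g) hε.le
  have h3 : (dtn Ω B g : Module.Dual ℝ (HHalf Ω)) (gε - g) = inner ℝ Λg e := hΛ (gε - g)
  have h4 : ‖e‖ * ‖e‖ =
      inner ℝ (gε : L2Surf (frontier Ω)) e - inner ℝ (g : L2Surf (frontier Ω)) e := by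
    rw [← inner_sub_left, ← he, real_inner_self_eq_norm_mul_norm]
  have h5 : -inner ℝ Λg e ≤ ‖Λg‖ * ‖e‖ := (neg_le_abs _).trans (abs_real_inner_le_norm _ _)
  have h6 : ‖e‖ * ‖e‖ ≤ ε * ‖Λg‖ * ‖e‖ := by
    rw [h3] at h2
    linarith [mul_le_mul_of_nonneg_left h5 hε.le]
  rcases (norm_nonneg e).eq_or_lt with h0 | h0
  · rw [← h0]; positivity
  · exact le_of_mul_le_mul_right h6 h0

end CMM

theorem mainTheorem2 {d : ℕ} (hd : 2 ≤ d) {Ω B : Set (CMM.Vec d)}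
    (hΩ : CMM.IsBoundedLipschitz Ω) (hB : CMM.IsBoundedLipschitz B) (hBΩ : closure B ⊆ Ω) :
    -- the Dirichlet-to-Neumann map `Λ = CMM.dtn Ω B` is well defined on `H^{1/2}(Γ)`
    (∀ g : CMM.HHalf Ω, (∃! v, CMM.IsDirichletSolution Ω B g v) ∧
      (∃! ℓ, CMM.IsDtN Ω B g ℓ) ∧ CMM.IsDtN Ω B g (CMM.dtn Ω B g)) ∧
    -- the regularised problem is uniquely solvable, and its solution satisfies the estimate
    ∀ (ε : ℝ), 0 < ε → ∀ g : CMM.HHalf Ω,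
      (∃! gε, CMM.IsRobinApproximation Ω B ε g gε) ∧
      ∀ gε : CMM.HHalf Ω, CMM.IsRobinApproximation Ω B ε g gε →
        ∀ Λg : CMM.L2Surf (frontier Ω), CMM.IsL2Function (CMM.dtn Ω B g) Λg →
          ‖(gε : CMM.L2Surf (frontier Ω)) - (g : CMM.L2Surf (frontier Ω))‖ ≤ ε * ‖Λg‖ := by
  have hd' : d ≠ 0 := by lia
  refine ⟨fun g => ⟨?_, CMM.existsUnique_isDtN hd' hΩ.isOpen hΩ.isBounded hBΩ g,
    CMM.isDtN_dtn hd' hΩ.isOpen hΩ.isBounded hBΩ g⟩, fun ε hε g => ⟨?_, fun gε h Λg hΛ =>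
    h.norm_sub_le hd' hΩ.isOpen hΩ.isBounded hBΩ hε hΛ⟩⟩
  · obtain ⟨v, hv⟩ := CMM.exists_isDirichletSolution hd' hΩ.isOpen hΩ.isBounded hBΩ g
    exact ⟨v, hv, fun v' hv' => hv'.unique hd' hΩ.isOpen hΩ.isBounded hv⟩
  · obtain ⟨gε, h⟩ := CMM.exists_isRobinApproximation hd' hΩ.isOpen hΩ.isBounded hBΩ hε g
    exact ⟨gε, h, fun g' h' => h'.unique hd' hΩ.isOpen hΩ.isBounded hBΩ hε h⟩
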